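/- Let $n\ge 0$ and $N=2n+1$. Let $\bigwedge\mathbb C^n$ be the Fermionic Fock space, i.e. the complex exterior algebra with unit (vacuum) $1$ and with the Hermitian scalar product $(\cdot,\cdot)$, antilinear in the left entry, for which the vectors $e_{s_1}\wedge\dots\wedge e_{s_k}$, $s_1<\dots<s_k$, form an orthonormal basis. For $v\in\mathbb C^n$ let $c^\dagger(v)\psi=v\wedge\psi$ and let $c(v)$ be the adjoint of $c^\dagger(v)$; for $1\le j\le n$ put $$\gamma_{2j-1}=c^\dagger(e_j)-c(e_j),\qquad \gamma_{2j}=-i\,(c^\dagger(e_j)+c(e_j)),$$ so that $\gamma_a\gamma_b+\gamma_b\gamma_a=-2\delta_{ab}$ for $1\le a,b\le 2n$. Let $C\ell(N)$ be the real Clifford algebra of Euclidean $\mathbb R^{N}$ with relations $vw+wv=-2\langle v,w\rangle$, and let $\mathrm{Spin}(N)\subset C\ell(N)$ be the spin group. The Lie algebra $\mathfrak{so}(N)$ of real antisymmetric matrices is identified with the Lie algebra of $\mathrm{Spin}(N)$ by $X\mapsto -\tfrac14\sum_{j,k}X_{jk}e_je_k$ (the inverse of the differential of the covering $\mathrm{Spin}(N)\to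 SO(N)$, $g\mapsto(v\mapsto gvg^{-1})$), and $e^{tX}\in\mathrm{Spin}(N)$ denotes the exponential in $C\ell(N)$ of $t$ times this element. The $1/2$-spin representation $\pi^{1/2}$ of $\mathrm{Spin}(N)$ on $\bigwedge\mathbb C^n$ is the restriction to $\mathrm{Spin}(N)$ of the homomorphism from the even subalgebra of $C\ell(N)$ to $\mathrm{End}(\bigwedge\mathbb C^n)$ determined by $e_{N}e_j\mapsto\gamma_j$, $e_je_k\mapsto\gamma_j\gamma_k$ ($j,k\le 2n$). The $1/2$-spin representation $\pi^{1/2}$ of $\mathfrak{so}(N)$ on $\bigwedge\mathbb C^n$, which is its differential, is given by $$X_{j,N}\mapsto\tfrac12\gamma_j,\qquad X_{jk}\mapsto-\tfrac12\gamma_j\gamma_k\qquad(j\neq k,\ j,k\le 2n),$$ where $X_{jk}$ is the matrix with entry $1$ at $(j,k)$, entry $-1$ at $(k,j)$, and zeros elsewhere. Let $L^2(\mathrm{Spin}(N))$ be formed with respect to the normalized Haar measure, let $R$ be the right regular representation, $(R_gf)(x)=f(xg)$, on $L^2(\mathrm{Spin}(N))$, and let $$(dR(X)f)(g)=\frac{d}{dt}f(ge^{tX})\Big|_{t=0},\qquad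 X\in\mathfrak{so}(N),\ f\in C^\infty(\mathrm{Spin}(N)).$$ **Lemma.** The linear map $$F^{1/2}:\textstyle\bigwedge\mathbb C^n\to L^2(\mathrm{Spin}(2n+1)),\qquad F^{1/2}\psi=\big(1,\pi^{1/2}(\cdot)\psi\big),$$ is an embedding (injective, and a homeomorphism onto its image). Let $F_{\Psi_0}$ be its range (with $\Psi_0=F^{1/2}(1)$). Then: 1. $F_{\Psi_0}$ is invariant under $R$, and the restriction of $R$ to $F_{\Psi_0}$ is a (continuous) representation of $\mathrm{Spin}(2n+1)$ which coincides, through the isomorphism $F^{1/2}:\bigwedge\mathbb C^n\to F_{\Psi_0}$, with the $1/2$-spin representation: $R_gF^{1/2}\psi=F^{1/2}\pi^{1/2}(g)\psi$. 2. Every function $g\mapsto(1,\pi^{1/2}(g)\psi)$ is smooth, so $F_{\Psi_0}\subset C^\infty(\mathrm{Spin}(2n+1))$; $F_{\Psi_0}$ is invariant under $dR$, and the restriction of $dR$ to $F_{\Psi_0}$ is a representation of the Lie algebra $\mathfrak{so}(2n+1)$ which coincides, through $F^{1/2}$, with the $1/2$-spin representation: $dR(X)F^{1/2}\psi=F^{1/2}\pi^{1/2}(X)\psi$.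 -/

import Mathlib

namespace SpinFock

open CliffordAlgebra MeasureTheory
open scoped ContDiff

section CliffordGeneral

variable {M : Type*} [AddCommGroup M] [Module ℝ M]

theorem ι_mul_sub_involute_mul (Q : QuadraticForm ℝ M) (v : M) (x : CliffordAlgebra Q) :
    ι Q v * x - involute x * ι Q v = contractLeft (QuadraticMap.polarBilin Q v) x := by
  induction x using CliffordAlgebra.left_induction with
  | algebraMap r =>
    rw [contractLeft_algebraMap, AlgHom.commutes, Algebra.commutes, sub_self]
  | add x y hx hy => rw [map_add, map_add, ← hx, ← hy]; noncomm_ring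
  | ι_mul x a hx =>
    rw [contractLeft_ι_mul, ← hx, map_mul, involute_ι]
    have h := ι_mul_ι_add_swap (Q := Q) v a
    have h2 : ι Q v * ι Q a = algebraMap ℝ _ (QuadraticMap.polar Q v a) - ι Q a * ι Q v := by
      rw [← h]; abel
    rw [← mul_assoc, h2, Algebra.smul_def, QuadraticMap.polarBilin_apply_apply]
    noncomm_ring

theorem exterior_scalar_of_contractLeft_eq_zero {ι' : Type*} [Fintype ι'] (b : Module.Basis ι' ℝ M)
    (x : ExteriorAlgebra ℝ M)
    (hx : ∀ d : Module.Dual ℝ M, contractLeft (Q := (0 : QuadraticForm ℝ M)) d x = 0) :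
    ∃ r : ℝ, x = algebraMap ℝ _ r := by
  classical
  let N : ExteriorAlgebra ℝ M →ₗ[ℝ] ExteriorAlgebra ℝ M :=
    ∑ i, (LinearMap.mulLeft ℝ (ExteriorAlgebra.ι ℝ (b i))) ∘ₗ
      (contractLeft (Q := (0 : QuadraticForm ℝ M)) (b.coord i))
  have N_apply : ∀ y, N y = ∑ i, ExteriorAlgebra.ι ℝ (b i) *
      contractLeft (Q := (0 : QuadraticForm ℝ M)) (b.coord i) y := by
    intro y; simp [N, LinearMap.sum_apply]
  have anti : ∀ a c : M, ExteriorAlgebra.ι ℝ a * ExteriorAlgebra.ι ℝ c =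
      - (ExteriorAlgebra.ι ℝ c * ExteriorAlgebra.ι ℝ a) := fun a c =>
    eq_neg_of_add_eq_zero_left (ExteriorAlgebra.ι_add_mul_swap a c)
  have N_mul : ∀ a y, N (ExteriorAlgebra.ι ℝ a * y) =
      ExteriorAlgebra.ι ℝ a * y + ExteriorAlgebra.ι ℝ a * N y := by
    intro a y
    rw [N_apply, N_apply, Finset.mul_sum]
    have h1 : ∀ i, ExteriorAlgebra.ι ℝ (b i) *
        contractLeft (Q := (0 : QuadraticForm ℝ M)) (b.coord i) (ExteriorAlgebra.ι ℝ a * y) =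
        (b.coord i a) • (ExteriorAlgebra.ι ℝ (b i) * y) + ExteriorAlgebra.ι ℝ a *
          (ExteriorAlgebra.ι ℝ (b i) *
            contractLeft (Q := (0 : QuadraticForm ℝ M)) (b.coord i) y) := by
      intro i
      have := contractLeft_ι_mul (Q := (0 : QuadraticForm ℝ M)) (b.coord i) a y
      change contractLeft (Q := (0 : QuadraticForm ℝ M)) (b.coord i) (ExteriorAlgebra.ι ℝ a * y) =
        _ - ExteriorAlgebra.ι ℝ a * _ at this
      rw [this, mul_sub, mul_smul_comm, ← mul_assoc, anti, ← mul_assoc]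
      noncomm_ring
    rw [Finset.sum_congr rfl fun i _ => h1 i, Finset.sum_add_distrib]
    congr 1
    conv_rhs => rw [← b.sum_repr a, map_sum, Finset.sum_mul]
    refine Finset.sum_congr rfl fun i _ => ?_
    rw [map_smul, smul_mul_assoc]; rfl
  have N_deg : ∀ (k : ℕ) (y : ExteriorAlgebra ℝ M), y ∈ ⋀[ℝ]^k M → N y = (k : ℝ) • y := by
    intro k y hy
    induction hy using Submodule.pow_induction_on_left' with
    | algebraMap r =>
      rw [N_apply]
      simp only [Nat.cast_zero, zero_smul]
      refine Finset.sum_eq_zero fun i _ => ?_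
      have := contractLeft_algebraMap (Q := (0 : QuadraticForm ℝ M)) (b.coord i) r
      rw [show contractLeft (Q := (0 : QuadraticForm ℝ M)) (b.coord i)
        (algebraMap ℝ (ExteriorAlgebra ℝ M) r) = 0 from this, mul_zero]
    | add x y i hx hy ihx ihy => rw [map_add, ihx, ihy, smul_add]
    | mem_mul m hm i x hx ih =>
      obtain ⟨a, rfl⟩ := hm
      rw [N_mul, ih, mul_smul_comm, Nat.cast_succ, add_smul, one_smul, add_comm]
  have N_comp : ∀ (y : ExteriorAlgebra ℝ M) (k : ℕ),
      ((DirectSum.decompose (fun i : ℕ => ⋀[ℝ]^i M) (N y)) k : ExteriorAlgebra ℝ M) =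
        (k : ℝ) • ((DirectSum.decompose (fun i : ℕ => ⋀[ℝ]^i M) y) k : ExteriorAlgebra ℝ M) := by
    intro y k
    induction y using DirectSum.Decomposition.inductionOn (fun i : ℕ => ⋀[ℝ]^i M) with
    | zero => simp
    | @homogeneous i m =>
      rw [N_deg i m m.2, DirectSum.decompose_smul, DirectSum.smul_apply, Submodule.coe_smul]
      by_cases hik : i = k
      · subst hik; rfl
      · rw [DirectSum.decompose_of_mem_ne (fun i : ℕ => ⋀[ℝ]^i M) m.2 hik]; simp
    | add m m' hm hm' => simp [hm, hm', smul_add]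
  have hN : N x = 0 := by
    rw [N_apply]; exact Finset.sum_eq_zero fun i _ => by rw [hx, mul_zero]
  have hk : ∀ k : ℕ, k ≠ 0 →
      ((DirectSum.decompose (fun i : ℕ => ⋀[ℝ]^i M) x) k : ExteriorAlgebra ℝ M) = 0 := by
    intro k hk
    have := N_comp x k
    rw [hN] at this
    simp only [DirectSum.decompose_zero, DirectSum.zero_apply, ZeroMemClass.coe_zero] at this
    exact (smul_eq_zero.mp this.symm).resolve_left (Nat.cast_ne_zero.mpr hk)
  have hx0 : x ∈ ⋀[ℝ]^0 M := by
    rw [← DirectSum.sum_support_decompose (fun i : ℕ => ⋀[ℝ]^i M) x]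
    refine Submodule.sum_mem _ fun k _ => ?_
    by_cases h : k = 0
    · subst h; exact SetLike.coe_mem _
    · rw [hk k h]; exact Submodule.zero_mem _
  rw [ExteriorAlgebra.exteriorPower, pow_zero] at hx0
  obtain ⟨r, hr⟩ := Submodule.mem_one.mp hx0
  exact ⟨r, hr.symm⟩

theorem clifford_scalar_of_contractLeft_eq_zero {ι' : Type*} [Fintype ι'] (b : Module.Basis ι' ℝ M)
    (Q : QuadraticForm ℝ M) (x : CliffordAlgebra Q)
    (hx : ∀ d : Module.Dual ℝ M, contractLeft d x = 0) :
    ∃ r : ℝ, x = algebraMap ℝ _ r := by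
  have : Invertible (2 : ℝ) := invertibleOfNonzero two_ne_zero
  obtain ⟨r, hr⟩ := exterior_scalar_of_contractLeft_eq_zero b (equivExterior Q x) (by
    intro d
    have := changeForm_contractLeft (changeForm.associated_neg_proof (Q := Q)) d x
    rw [hx, map_zero] at this
    exact this.symm)
  refine ⟨r, (equivExterior Q).injective ?_⟩
  rw [hr]
  exact (changeForm_algebraMap (changeForm.associated_neg_proof (Q := Q)) r).symm

end CliffordGeneral

/-- The quadratic form `v ↦ -⟪v, v⟫` on `ℝ^N`. -/
noncomputable def negForm (N : ℕ) : QuadraticForm ℝ (EuclideanSpace ℝ (Fin N)) :=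
  -(LinearMap.BilinMap.toQuadraticMap (innerₗ (EuclideanSpace ℝ (Fin N))))

theorem negForm_apply (N : ℕ) (v : EuclideanSpace ℝ (Fin N)) : negForm N v = -‖v‖ ^ 2 := by
  simp [negForm]

theorem polar_negForm (N : ℕ) (v w : EuclideanSpace ℝ (Fin N)) :
    QuadraticMap.polar (negForm N) v w = -2 * inner ℝ v w := by
  simp only [QuadraticMap.polar, negForm_apply, norm_add_sq_real]; ring

/-- The real Clifford algebra of `ℝ^N`, with relations `v w + w v = -2 ⟪v, w⟫`. -/
abbrev Cl (N : ℕ) : Type := CliffordAlgebra (negForm N)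

/-- The compact spin group `Spin(N)`. -/
abbrev Spin (N : ℕ) : Type := spinGroup (negForm N)

/-- The inclusion of vectors in the Clifford algebra. -/
noncomputable abbrev vec {N : ℕ} : EuclideanSpace ℝ (Fin N) →ₗ[ℝ] Cl N := ι (negForm N)

theorem vec_sq {N : ℕ} (v : EuclideanSpace ℝ (Fin N)) :
    vec v * vec v = algebraMap ℝ (Cl N) (-‖v‖ ^ 2) := by
  rw [ι_sq_scalar, negForm_apply]

theorem vec_swap {N : ℕ} (v w : EuclideanSpace ℝ (Fin N)) :
    vec v * vec w + vec w * vec v = algebraMap ℝ (Cl N) (-2 * inner ℝ v w) := by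
  rw [ι_mul_ι_add_swap, polar_negForm]

instance (N : ℕ) : Nontrivial (Cl N) :=
  have : Invertible (2 : ℝ) := invertibleOfNonzero two_ne_zero
  inferInstance

theorem algebraMap_Cl_injective (N : ℕ) : Function.Injective (algebraMap ℝ (Cl N)) :=
  (algebraMap ℝ (Cl N)).injective

theorem vec_injective (N : ℕ) : Function.Injective (vec (N := N)) := by
  rw [injective_iff_map_eq_zero]
  intro v hv
  have h := vec_sq v
  rw [hv, mul_zero] at h
  have : -‖v‖ ^ 2 = 0 := algebraMap_Cl_injective N (by rw [← h, map_zero])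
  simpa using this

theorem scalar_of_twisted_comm {N : ℕ} (y : Cl N)
    (hy : ∀ v, vec v * y = involute y * vec v) : ∃ r : ℝ, y = algebraMap ℝ _ r := by
  refine clifford_scalar_of_contractLeft_eq_zero (EuclideanSpace.basisFun (Fin N) ℝ).toBasis _ y ?_
  intro d
  obtain ⟨w, hw⟩ := (InnerProductSpace.toDual ℝ (EuclideanSpace ℝ (Fin N))).surjective
    (LinearMap.toContinuousLinearMap d)
  have hd : d = QuadraticMap.polarBilin (negForm N) ((-(1/2) : ℝ) • w) := by
    ext v
    have := congrArg (fun f => f v) hw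
    simp only [InnerProductSpace.toDual_apply_apply, LinearMap.coe_toContinuousLinearMap'] at this
    rw [QuadraticMap.polarBilin_apply_apply, polar_negForm, inner_smul_left, this]
    simp
  rw [hd, ← ι_mul_sub_involute_mul, hy, sub_self]

/-- Products of unit vectors. -/
theorem unit_mul_reflection {N : ℕ} (u v : EuclideanSpace ℝ (Fin N)) (hu : ‖u‖ = 1) :
    vec u * vec v = - (vec ((ℝ ∙ u)ᗮ.reflection v) * vec u) := by
  have h1 : (ℝ ∙ u)ᗮ.reflection v = v - (2 * inner ℝ u v) • u := by
    rw [Submodule.reflection_orthogonal_apply, Submodule.reflection_singleton_apply, hu]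
    simp [two_smul, mul_smul]
  have h2 := vec_swap u v
  have h3 := vec_sq u
  rw [hu] at h3
  rw [h1, map_sub, map_smul, sub_mul, smul_mul_assoc, h3, eq_sub_of_add_eq h2]
  simp only [Algebra.algebraMap_eq_smul_one, smul_smul]
  rw [neg_sub, sub_left_inj, ← sub_eq_zero, ← sub_smul]
  ring_nf; simp

section Criterion

variable {N : ℕ}

theorem star_vec_mul_self (u : EuclideanSpace ℝ (Fin N)) (hu : ‖u‖ = 1) :
    star (vec u) * vec u = 1 := by
  rw [star_ι, neg_mul, vec_sq, hu]; simp

theorem vec_mul_star_self (u : EuclideanSpace ℝ (Fin N)) (hu : ‖u‖ = 1) :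
    vec u * star (vec u) = 1 := by
  rw [star_ι, mul_neg, vec_sq, hu]; simp

theorem star_prod_mul_self (l : List (EuclideanSpace ℝ (Fin N))) (hl : ∀ u ∈ l, ‖u‖ = 1) :
    star (l.map vec).prod * (l.map vec).prod = 1 ∧
      (l.map vec).prod * star (l.map vec).prod = 1 := by
  induction l with
  | nil => simp
  | cons u l ih =>
    obtain ⟨h1, h2⟩ := ih fun w hw => hl w (List.mem_cons_of_mem _ hw)
    have hu := hl u List.mem_cons_self
    simp only [List.map_cons, List.prod_cons, star_mul]
    constructor
    · rw [mul_assoc, ← mul_assoc (star (vec u)), star_vec_mul_self u hu, one_mul, h1]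
    · rw [mul_assoc, ← mul_assoc _ _ (star (vec u)), h2, one_mul, vec_mul_star_self u hu]

theorem prod_mul_vec (l : List (EuclideanSpace ℝ (Fin N))) (hl : ∀ u ∈ l, ‖u‖ = 1)
    (v : EuclideanSpace ℝ (Fin N)) :
    (l.map vec).prod * vec v = (-1 : ℝ) ^ l.length •
      (vec ((l.map fun u => (ℝ ∙ u)ᗮ.reflection).prod v) * (l.map vec).prod) := by
  induction l with
  | nil => simp
  | cons u l ih =>
    have ih := ih fun w hw => hl w (List.mem_cons_of_mem _ hw)
    have hu := hl u List.mem_cons_self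
    simp only [List.map_cons, List.prod_cons, List.length_cons]
    rw [mul_assoc, ih, mul_smul_comm, ← mul_assoc, unit_mul_reflection _ _ hu, pow_succ,
      LinearIsometryEquiv.coe_mul, Function.comp_apply]
    simp [mul_assoc]

theorem exists_unit_reflections (φ : EuclideanSpace ℝ (Fin N) ≃ₗᵢ[ℝ] EuclideanSpace ℝ (Fin N)) :
    ∃ l : List (EuclideanSpace ℝ (Fin N)), l.length ≤ N ∧ (∀ u ∈ l, ‖u‖ = 1) ∧
      φ = (l.map fun u => (ℝ ∙ u)ᗮ.reflection).prod := by
  obtain ⟨l, hl, hφ⟩ := φ.reflections_generate_dim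
  rw [finrank_euclideanSpace_fin] at hl
  have key : ∀ l : List (EuclideanSpace ℝ (Fin N)), ∃ l' : List (EuclideanSpace ℝ (Fin N)),
      l'.length ≤ l.length ∧ (∀ u ∈ l', ‖u‖ = 1) ∧
      (l.map fun u => (ℝ ∙ u)ᗮ.reflection).prod = (l'.map fun u => (ℝ ∙ u)ᗮ.reflection).prod := by
    intro l
    induction l with
    | nil => exact ⟨[], le_rfl, by simp, rfl⟩
    | cons u l ih =>
      obtain ⟨l', h1, h2, h3⟩ := ih
      by_cases hu : u = 0
      · refine ⟨l', h1.trans (by simp), h2, ?_⟩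
        rw [List.map_cons, List.prod_cons, h3, hu]
        convert one_mul _
        ext v : 1
        rw [Submodule.reflection_orthogonal_apply]
        simp
      · refine ⟨(‖u‖⁻¹ • u) :: l', by simpa using h1, ?_, ?_⟩
        · intro w hw
          rcases List.mem_cons.mp hw with rfl | hw
          · exact norm_smul_inv_norm (𝕜 := ℝ) hu
          · exact h2 w hw
        · have hs : (ℝ ∙ u) = (ℝ ∙ (‖u‖⁻¹ • u)) :=
            (Submodule.span_singleton_smul_eq
              (IsUnit.mk0 _ (inv_ne_zero (norm_ne_zero_iff.mpr hu))) u).symm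
          simp only [List.map_cons, List.prod_cons, h3]
          congr! 3
  obtain ⟨l', h1, h2, h3⟩ := key l
  exact ⟨l', h1.trans hl, h2, hφ.trans h3⟩

theorem exists_prod_of_criterion (x : Cl N) (he : x ∈ even (negForm N)) (h1 : star x * x = 1)
    (h2 : x * star x = 1) (hv : ∀ v, x * vec v * star x ∈ LinearMap.range (vec (N := N))) :
    ∃ (c : ℝ) (l : List (EuclideanSpace ℝ (Fin N))), (c = 1 ∨ c = -1) ∧ l.length ≤ N ∧
      (∀ u ∈ l, ‖u‖ = 1) ∧ x = c • (l.map vec).prod := by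
  choose f hf using hv
  have hlin : ∃ g : EuclideanSpace ℝ (Fin N) →ₗ[ℝ] EuclideanSpace ℝ (Fin N), ∀ v, g v = f v :=
    ⟨{ toFun := f
       map_add' := fun v w => vec_injective N (by
        rw [map_add, hf, hf, hf, map_add]; noncomm_ring)
       map_smul' := fun c v => vec_injective N (by
        rw [map_smul, hf, hf, map_smul, RingHom.id_apply, mul_smul_comm, smul_mul_assoc]) },
      fun _ => rfl⟩
  obtain ⟨g, hg⟩ := hlin
  have hiso : ∀ v, ‖g v‖ = ‖v‖ := by
    intro v
    have h : vec (g v) * vec (g v) = vec v * vec v := by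
      rw [hg, hf]
      calc x * vec v * star x * (x * vec v * star x)
          = x * vec v * (star x * x) * vec v * star x := by noncomm_ring
        _ = x * (vec v * vec v) * star x := by rw [h1]; noncomm_ring
        _ = vec v * vec v := by
          rw [vec_sq, ← Algebra.commutes, mul_assoc, h2, mul_one]
    rw [vec_sq, vec_sq] at h
    have h := algebraMap_Cl_injective N h
    exact (sq_eq_sq₀ (norm_nonneg _) (norm_nonneg _)).mp (by linarith)
  let gi : EuclideanSpace ℝ (Fin N) →ₗᵢ[ℝ] EuclideanSpace ℝ (Fin N) := ⟨g, hiso⟩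
  let φ : EuclideanSpace ℝ (Fin N) ≃ₗᵢ[ℝ] EuclideanSpace ℝ (Fin N) :=
    gi.toLinearIsometryEquiv rfl
  have hφ : ∀ v, φ v = g v := fun v => by simp [φ, gi]
  have hx : ∀ v, x * vec v = vec (φ v) * x := by
    intro v
    rw [hφ, hg, hf, mul_assoc, h1, mul_one]
  obtain ⟨l, hlen, hl, hprod⟩ := exists_unit_reflections φ
  have hP := fun v => prod_mul_vec l hl v
  rw [← hprod] at hP
  obtain ⟨hP1, hP2⟩ := star_prod_mul_self l hl
  have hinv := involute_prod_map_ι (Q := negForm N) l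
  set P := (l.map (vec (N := N))).prod with hPdef
  set s : ℝ := (-1 : ℝ) ^ l.length with hs
  have hss : s * s = 1 := by rw [hs, ← mul_pow]; simp
  have hvφ : ∀ v, vec (φ v) = s • (P * vec v * star P) := by
    intro v
    rw [hP, smul_mul_assoc, mul_assoc, hP2, mul_one, smul_smul, hss, one_smul]
  have hPs : involute (star P) = s • star P := by
    rw [star_def', involute_involute, ← star_def', star_def, hinv, map_smul, smul_smul, hss, one_smul]
  obtain ⟨r, hr⟩ := scalar_of_twisted_comm (star P * x) (by
    intro v
    rw [map_mul, hPs, involute_eq_of_mem_even he, smul_mul_assoc, smul_mul_assoc, mul_assoc, hx,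
      hvφ, smul_mul_assoc, mul_smul_comm, smul_smul, hss, one_smul]
    calc vec v * (star P * x) = (1 : Cl N) * vec v * (star P * x) := by rw [one_mul]
      _ = star P * (P * vec v * star P * x) := by rw [← hP1]; noncomm_ring)
  have hxr : x = r • P := by
    calc x = P * (star P * x) := by rw [← mul_assoc, hP2, one_mul]
      _ = r • P := by rw [hr, ← Algebra.commutes, Algebra.smul_def]
  have hr2 : r * r = 1 := by
    rw [hxr, CliffordAlgebra.star_smul, smul_mul_assoc, mul_smul_comm, smul_smul, hP1,
      ← Algebra.algebraMap_eq_smul_one, ← map_one (algebraMap ℝ (Cl N))] at h1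
    exact algebraMap_Cl_injective N h1
  exact ⟨r, l, mul_self_eq_one_iff.mp hr2, hlen, hl, hxr⟩

theorem mem_lipschitz_of_prod (hN : 0 < N) (c : ℝ) (hc : c = 1 ∨ c = -1)
    (l : List (EuclideanSpace ℝ (Fin N))) (hl : ∀ u ∈ l, ‖u‖ = 1) :
    c • (l.map vec).prod ∈
      (lipschitzGroup (negForm N)).toSubmonoid.map (Units.coeHom (Cl N)) := by
  have hvec : ∀ u : EuclideanSpace ℝ (Fin N), ‖u‖ = 1 → vec u ∈
      (lipschitzGroup (negForm N)).toSubmonoid.map (Units.coeHom (Cl N)) := by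
    intro u hu
    refine ⟨⟨vec u, star (vec u), vec_mul_star_self u hu, star_vec_mul_self u hu⟩, ?_, rfl⟩
    exact Subgroup.subset_closure ⟨u, rfl⟩
  have hP : (l.map vec).prod ∈
      (lipschitzGroup (negForm N)).toSubmonoid.map (Units.coeHom (Cl N)) := by
    refine Submonoid.list_prod_mem _ fun x hx => ?_
    obtain ⟨u, hu, rfl⟩ := List.mem_map.mp hx
    exact hvec u (hl u hu)
  rcases hc with rfl | rfl
  · rwa [one_smul]
  · have hu : ‖EuclideanSpace.single (⟨0, hN⟩ : Fin N) (1 : ℝ)‖ = 1 := by simp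
    have := mul_mem (mul_mem (hvec _ hu) (hvec _ hu)) hP
    rw [vec_sq, hu] at this
    rw [Algebra.smul_def]
    simpa using this

/-- The group `Spin(N)` consists of the even elements `x` with `x x* = x* x = 1` for which
`v ↦ x v x*` preserves the space of vectors. -/
theorem mem_spinGroup_iff (hN : 0 < N) (x : Cl N) :
    x ∈ spinGroup (negForm N) ↔ x ∈ even (negForm N) ∧ star x * x = 1 ∧ x * star x = 1 ∧
      ∀ v, x * vec v * star x ∈ LinearMap.range (vec (N := N)) := by
  constructor
  · intro hx
    have : Invertible (2 : ℝ) := invertibleOfNonzero two_ne_zero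
    refine ⟨spinGroup.mem_even hx, spinGroup.star_mul_self_of_mem hx,
      spinGroup.mul_star_self_of_mem hx, fun v => ?_⟩
    have := spinGroup.conjAct_smul_ι_mem_range_ι
      (x := ⟨x, star x, spinGroup.mul_star_self_of_mem hx, spinGroup.star_mul_self_of_mem hx⟩) hx v
    rwa [ConjAct.units_smul_def] at this
  · rintro ⟨he, h1, h2, hv⟩
    obtain ⟨c, l, hc, -, hl, rfl⟩ := exists_prod_of_criterion x he h1 h2 hv
    exact ⟨⟨mem_lipschitz_of_prod hN c hc l hl, h1, h2⟩, he⟩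

end Criterion

section Topology

/-- A linear basis of the Clifford algebra. -/
noncomputable def clBasis (N : ℕ) : Module.Basis (Finset (Fin N)) ℝ (Cl N) :=
  letI : Invertible (2 : ℝ) := invertibleOfNonzero two_ne_zero
  (EuclideanSpace.basisFun (Fin N) ℝ).toBasis.ExteriorAlgebra.map (equivExterior (negForm N)).symm

/-- The left regular representation by matrices; it is used only to norm the finite-dimensional
algebra `Cl N`. -/
noncomputable def clToMatrix (N : ℕ) :
    Cl N →ₐ[ℝ] Matrix (Finset (Fin N)) (Finset (Fin N)) ℝ :=
  Algebra.leftMulMatrix (clBasis N)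

attribute [local instance] Matrix.linftyOpNormedRing Matrix.linftyOpNormedAlgebra

/-- A submultiplicative norm on the finite-dimensional algebra `Cl N`. It fixes the unique Hausdorff
vector space topology. -/
noncomputable instance instNormedRingCl (N : ℕ) : NormedRing (Cl N) :=
  NormedRing.induced (Cl N) (Matrix (Finset (Fin N)) (Finset (Fin N)) ℝ) (clToMatrix N)
    (Algebra.leftMulMatrix_injective (clBasis N))

noncomputable instance instNormedAlgebraCl (N : ℕ) : NormedAlgebra ℝ (Cl N) :=
  NormedAlgebra.induced ℝ (Cl N) (Matrix (Finset (Fin N)) (Finset (Fin N)) ℝ) (clToMatrix N)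

instance instFiniteDimensionalCl (N : ℕ) : FiniteDimensional ℝ (Cl N) :=
  Module.Finite.of_basis (clBasis N)

instance (N : ℕ) : CompleteSpace (Cl N) := FiniteDimensional.complete ℝ (Cl N)

instance (N : ℕ) : ProperSpace (Cl N) := FiniteDimensional.proper ℝ (Cl N)


/-- The conjugation `x ↦ x*` as a linear map. -/
noncomputable def starLin (N : ℕ) : Cl N →ₗ[ℝ] Cl N :=
  reverse ∘ₗ (involute : Cl N →ₐ[ℝ] Cl N).toLinearMap

theorem continuous_star_Cl (N : ℕ) : Continuous (star : Cl N → Cl N) :=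
  (starLin N).continuous_of_finiteDimensional

instance (N : ℕ) : IsTopologicalGroup (Spin N) where
  continuous_mul := by
    refine Continuous.subtype_mk ?_ _
    fun_prop
  continuous_inv := by
    refine Continuous.subtype_mk ((continuous_star_Cl N).comp continuous_subtype_val) _

theorem isClosed_spinGroup {N : ℕ} (hN : 0 < N) : IsClosed (spinGroup (negForm N) : Set (Cl N)) := by
  have : (spinGroup (negForm N) : Set (Cl N)) = {x | x ∈ evenOdd (negForm N) 0} ∩
      ({x | star x * x = 1} ∩ ({x | x * star x = 1} ∩
        ⋂ v, {x | x * vec v * star x ∈ LinearMap.range (vec (N := N))})) := by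
    ext x
    simp only [SetLike.mem_coe, mem_spinGroup_iff hN, Set.mem_inter_iff, Set.mem_ofPred_eq,
      Set.mem_iInter]
    rfl
  have hs := continuous_star_Cl N
  rw [this]
  refine IsClosed.inter (Submodule.closed_of_finiteDimensional (evenOdd (negForm N) 0))
    (IsClosed.inter ?_ (IsClosed.inter ?_ (isClosed_iInter fun v => ?_)))
  · exact isClosed_eq (by fun_prop) continuous_const
  · exact isClosed_eq (by fun_prop) continuous_const
  · exact (Submodule.closed_of_finiteDimensional (LinearMap.range (vec (N := N)))).preimage
      (f := fun x : Cl N => x * vec v * star x) (by fun_prop)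

theorem isBounded_spinGroup {N : ℕ} (hN : 0 < N) :
    Bornology.IsBounded (spinGroup (negForm N) : Set (Cl N)) := by
  obtain ⟨C, hC0, hC⟩ : ∃ C : ℝ, 1 ≤ C ∧ ∀ u : EuclideanSpace ℝ (Fin N), ‖u‖ = 1 → ‖vec u‖ ≤ C := by
    let L := LinearMap.toContinuousLinearMap (vec (N := N))
    refine ⟨max 1 ‖L‖, le_max_left _ _, fun u hu => ?_⟩
    have := L.le_opNorm u
    rw [hu, mul_one] at this
    exact this.trans (le_max_right _ _)
  have key : ∀ l : List (EuclideanSpace ℝ (Fin N)), (∀ u ∈ l, ‖u‖ = 1) →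
      ‖(l.map vec).prod‖ ≤ C ^ l.length * ‖(1 : Cl N)‖ := by
    intro l
    induction l with
    | nil => simp
    | cons u l ih =>
      intro hl
      have h1 := ih fun w hw => hl w (List.mem_cons_of_mem _ hw)
      rw [List.map_cons, List.prod_cons, List.length_cons, pow_succ', mul_assoc]
      exact (norm_mul_le _ _).trans
        (mul_le_mul (hC u (hl u List.mem_cons_self)) h1 (norm_nonneg _) (by linarith))
  refine isBounded_iff_forall_norm_le.mpr ⟨C ^ N * ‖(1 : Cl N)‖, fun x hx => ?_⟩
  obtain ⟨he, h1, h2, hv⟩ := (mem_spinGroup_iff hN x).mp hx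
  obtain ⟨c, l, hc, hlen, hl, rfl⟩ := exists_prod_of_criterion x he h1 h2 hv
  have hcn : ‖c‖ = 1 := by rcases hc with rfl | rfl <;> simp
  rw [norm_smul, hcn, one_mul]
  refine (key l hl).trans (mul_le_mul_of_nonneg_right ?_ (norm_nonneg _))
  exact pow_le_pow_right₀ hC0 hlen

instance (N : ℕ) [NeZero N] : CompactSpace (Spin N) :=
  isCompact_iff_compactSpace.mp
    (Metric.isCompact_of_isClosed_isBounded (isClosed_spinGroup (NeZero.pos N))
      (isBounded_spinGroup (NeZero.pos N)))

noncomputable instance (N : ℕ) : MeasurableSpace (Spin N) := borel _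

instance (N : ℕ) : BorelSpace (Spin N) := ⟨rfl⟩

end Topology

section LieAlgebra

variable {N : ℕ}

/-- The standard basis vector `e_j`, seen in the Clifford algebra. -/
noncomputable def cliffE (j : Fin N) : Cl N := vec (EuclideanSpace.single j (1 : ℝ))

/-- The quadratic element `-(1/4) ∑ A_{jk} e_j e_k` attached to a matrix `A`. -/
noncomputable def quadElt (N : ℕ) : Matrix (Fin N) (Fin N) ℝ →ₗ[ℝ] Cl N where
  toFun A := (-(1 / 4) : ℝ) • ∑ j, ∑ k, A j k • (cliffE j * cliffE k)
  map_add' A B := by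
    simp only [Matrix.add_apply, add_smul, Finset.sum_add_distrib, smul_add]
  map_smul' c A := by
    simp only [Matrix.smul_apply, smul_eq_mul, mul_smul, ← Finset.smul_sum, RingHom.id_apply]
    rw [smul_comm]

theorem quadElt_apply (A : Matrix (Fin N) (Fin N) ℝ) :
    quadElt N A = (-(1 / 4) : ℝ) • ∑ j, ∑ k, A j k • (cliffE j * cliffE k) := rfl

theorem cliffE_swap (j k : Fin N) :
    cliffE j * cliffE k = algebraMap ℝ (Cl N) (if j = k then -2 else 0) - cliffE k * cliffE j := by
  rw [eq_sub_iff_add_eq, cliffE, cliffE, vec_swap, EuclideanSpace.inner_single_left]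
  congr 1
  by_cases h : j = k <;> simp [h]

theorem quadElt_commutator_cliffE (A : Matrix (Fin N) (Fin N) ℝ) (hA : A.transpose = -A)
    (i : Fin N) :
    quadElt N A * cliffE i - cliffE i * quadElt N A = ∑ l, A l i • cliffE l := by
  have h : ∀ j k : Fin N, cliffE j * cliffE k * cliffE i - cliffE i * (cliffE j * cliffE k) =
      (if k = i then (-2 : ℝ) else 0) • cliffE j - (if i = j then (-2 : ℝ) else 0) • cliffE k := by
    intro j k
    rw [mul_assoc, cliffE_swap k i, ← mul_assoc (cliffE i), cliffE_swap i j, mul_sub, sub_mul,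
      ← Algebra.commutes, Algebra.smul_def, Algebra.smul_def]
    noncomm_ring
  have hA' : ∀ j k, A j k = - A k j := fun j k => by
    have := congrFun (congrFun hA k) j
    simpa using this
  rw [quadElt_apply, smul_mul_assoc, mul_smul_comm, ← smul_sub, Finset.sum_mul, Finset.mul_sum,
    ← Finset.sum_sub_distrib]
  have h2 : ∀ j : Fin N, (∑ k, A j k • (cliffE j * cliffE k)) * cliffE i -
      cliffE i * ∑ k, A j k • (cliffE j * cliffE k) =
      (-2 * A j i) • cliffE j - ∑ k, (if i = j then (-2 : ℝ) else 0) • A j k • cliffE k := by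
    intro j
    rw [Finset.sum_mul, Finset.mul_sum, ← Finset.sum_sub_distrib]
    simp_rw [smul_mul_assoc, mul_smul_comm, ← smul_sub, h, smul_sub]
    rw [Finset.sum_sub_distrib]
    congr 1
    · rw [Finset.sum_eq_single i]
      · simp [smul_smul, mul_comm]
      · intro b _ hb; simp [hb]
      · simp
    · exact Finset.sum_congr rfl fun k _ => smul_comm _ _ _
  rw [Finset.sum_congr rfl fun j _ => h2 j, Finset.sum_sub_distrib]
  have h3 : ∑ j, ∑ k, (if i = j then (-2 : ℝ) else 0) • A j k • cliffE k =
      ∑ l, (2 * A l i) • cliffE (N := N) l := by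
    rw [Finset.sum_eq_single i]
    · refine Finset.sum_congr rfl fun k _ => ?_
      rw [if_pos rfl, smul_smul, hA' i k]; ring_nf
    · intro b _ hb; simp [Ne.symm hb]
    · simp
  rw [h3, ← Finset.sum_sub_distrib, Finset.smul_sum]
  refine Finset.sum_congr rfl fun l _ => ?_
  rw [← sub_smul, smul_smul]
  ring_nf

theorem vec_eq_sum (v : EuclideanSpace ℝ (Fin N)) : vec v = ∑ i, v i • cliffE i := by
  conv_lhs => rw [← (EuclideanSpace.basisFun (Fin N) ℝ).sum_repr v, map_sum]
  simp [cliffE]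

/-- The element `quadElt A` acts on vectors by commutators as the matrix `A`. -/
theorem quadElt_commutator_vec (A : Matrix (Fin N) (Fin N) ℝ) (hA : A.transpose = -A)
    (v : EuclideanSpace ℝ (Fin N)) :
    quadElt N A * vec v - vec v * quadElt N A = vec (Matrix.toEuclideanLin A v) := by
  rw [vec_eq_sum v, vec_eq_sum, Finset.mul_sum, Finset.sum_mul, ← Finset.sum_sub_distrib]
  simp_rw [mul_smul_comm, smul_mul_assoc, ← smul_sub, quadElt_commutator_cliffE A hA]
  simp_rw [Finset.smul_sum]
  rw [Finset.sum_comm]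
  refine Finset.sum_congr rfl fun l _ => ?_
  simp_rw [smul_smul, ← Finset.sum_smul]
  congr 1
  simp [Matrix.mulVec, dotProduct, mul_comm]

theorem quadElt_commutator (A B : Matrix (Fin N) (Fin N) ℝ) (hA : A.transpose = -A) :
    quadElt N A * quadElt N B - quadElt N B * quadElt N A = quadElt N (A * B - B * A) := by
  have hA' : ∀ j k, A j k = - A k j := fun j k => by
    have := congrFun (congrFun hA k) j
    simpa using this
  have h1 : ∀ j k : Fin N, quadElt N A * (cliffE j * cliffE k) -
      cliffE j * cliffE k * quadElt N A =
      ∑ l, A l j • (cliffE l * cliffE k) + ∑ l, A l k • (cliffE j * cliffE l) := by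
    intro j k
    have e1 := quadElt_commutator_cliffE A hA j
    have e2 := quadElt_commutator_cliffE A hA k
    have : quadElt N A * (cliffE j * cliffE k) - cliffE j * cliffE k * quadElt N A =
        (quadElt N A * cliffE j - cliffE j * quadElt N A) * cliffE k +
        cliffE j * (quadElt N A * cliffE k - cliffE k * quadElt N A) := by noncomm_ring
    rw [this, e1, e2, Finset.sum_mul, Finset.mul_sum]
    simp_rw [smul_mul_assoc, mul_smul_comm]
  have e : quadElt N A * quadElt N B - quadElt N B * quadElt N A = (-(1 / 4) : ℝ) • ∑ j, ∑ k,
      B j k • (∑ l, A l j • (cliffE l * cliffE k) + ∑ l, A l k • (cliffE j * cliffE l)) := by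
    rw [quadElt_apply B, mul_smul_comm, smul_mul_assoc, ← smul_sub, Finset.mul_sum,
      Finset.sum_mul, ← Finset.sum_sub_distrib]
    congr 1
    refine Finset.sum_congr rfl fun j _ => ?_
    rw [Finset.mul_sum, Finset.sum_mul, ← Finset.sum_sub_distrib]
    refine Finset.sum_congr rfl fun k _ => ?_
    rw [mul_smul_comm, smul_mul_assoc, ← smul_sub, h1]
  rw [e, map_sub, quadElt_apply (A * B), quadElt_apply (B * A), ← smul_sub]
  congr 1
  simp only [smul_add, Finset.sum_add_distrib, sub_eq_add_neg]
  congr 1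
  · simp_rw [Finset.smul_sum, smul_smul, Matrix.mul_apply, Finset.sum_smul]
    rw [Finset.sum_comm]
    conv_rhs => rw [Finset.sum_comm]
    refine Finset.sum_congr rfl fun k _ => ?_
    rw [Finset.sum_comm]
    refine Finset.sum_congr rfl fun j _ => ?_
    refine Finset.sum_congr rfl fun l _ => ?_
    rw [mul_comm]
  · simp_rw [← Finset.sum_neg_distrib, Finset.smul_sum, smul_smul, Matrix.mul_apply,
      Finset.sum_smul, ← Finset.sum_neg_distrib, ← neg_smul]
    refine Finset.sum_congr rfl fun j _ => ?_
    rw [Finset.sum_comm]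
    refine Finset.sum_congr rfl fun l _ => ?_
    refine Finset.sum_congr rfl fun k _ => ?_
    rw [hA' l k, mul_neg]

end LieAlgebra

end SpinFock

attribute [local instance] LieRing.ofAssociativeRing

namespace SpinFock

open CliffordAlgebra MeasureTheory
open scoped ContDiff

section Exponential

variable {N : ℕ}

/-- The Lie algebra `𝔰𝔬(N)` of antisymmetric real matrices. -/
abbrev so (N : ℕ) : LieSubalgebra ℝ (Matrix (Fin N) (Fin N) ℝ) :=
  LieAlgebra.Orthogonal.so (Fin N) ℝ

theorem so_transpose (X : so N) : (X : Matrix (Fin N) (Fin N) ℝ).transpose = -X :=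
  (LieAlgebra.Orthogonal.mem_so (Fin N) ℝ _).mp X.2

theorem star_cliffE_mul (j k : Fin N) : star (cliffE j * cliffE k) = cliffE k * cliffE j := by
  simp [cliffE, star_mul]

theorem star_quadElt (A : Matrix (Fin N) (Fin N) ℝ) :
    star (quadElt N A) = quadElt N A.transpose := by
  rw [quadElt_apply, quadElt_apply, CliffordAlgebra.star_smul, star_sum, Finset.sum_comm]
  congr 1
  rw [Finset.sum_comm]
  simp_rw [star_sum, CliffordAlgebra.star_smul, star_cliffE_mul, Matrix.transpose_apply]
  rw [Finset.sum_comm]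

theorem quadElt_mem_even (A : Matrix (Fin N) (Fin N) ℝ) : quadElt N A ∈ even (negForm N) := by
  rw [quadElt_apply]
  refine Subalgebra.smul_mem _ (Subalgebra.sum_mem _ fun j _ => Subalgebra.sum_mem _ fun k _ =>
    Subalgebra.smul_mem _ ?_ _) _
  exact ι_mul_ι_mem_evenOdd_zero _ _ _

instance (N : ℕ) : ContinuousStar (Cl N) := ⟨continuous_star_Cl N⟩

theorem exp_mem_even (q : Cl N) (hq : q ∈ even (negForm N)) :
    NormedSpace.exp q ∈ even (negForm N) := by
  have hs := NormedSpace.exp_series_hasSum_exp' (𝕂 := ℝ) q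
  refine (Submodule.closed_of_finiteDimensional (evenOdd (negForm N) 0)).mem_of_tendsto hs
    (Filter.Eventually.of_forall fun s => ?_)
  exact Subalgebra.sum_mem (even (negForm N)) fun n _ =>
    Subalgebra.smul_mem _ (Subalgebra.pow_mem _ hq _) _

/-- Conjugation by the exponential of `quadElt A` is the rotation `exp A`. -/
theorem exp_quadElt_conj (A : Matrix (Fin N) (Fin N) ℝ) (hA : A.transpose = -A)
    (v : EuclideanSpace ℝ (Fin N)) :
    ∃ w, NormedSpace.exp (quadElt N A) * vec v * NormedSpace.exp (-quadElt N A) = vec w := by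
  let _ : NormedAlgebra ℚ (Cl N) := NormedAlgebra.restrictScalars ℚ ℝ (Cl N)
  set q := quadElt N A with hq
  let L : EuclideanSpace ℝ (Fin N) →L[ℝ] EuclideanSpace ℝ (Fin N) :=
    LinearMap.toContinuousLinearMap (Matrix.toEuclideanLin A)
  let V : EuclideanSpace ℝ (Fin N) →L[ℝ] Cl N := LinearMap.toContinuousLinearMap vec
  let w : ℝ → EuclideanSpace ℝ (Fin N) := fun t => NormedSpace.exp (t • L) v
  have hw : ∀ t, HasDerivAt w (L (w t)) t := by
    intro t
    have h1 := (hasDerivAt_exp_smul_const' (𝕂 := ℝ) L t).clm_apply (hasDerivAt_const t v)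
    simpa [w] using h1
  have hV : ∀ t, HasDerivAt (fun t => V (w t)) (V (L (w t))) t := fun t =>
    V.hasFDerivAt.comp_hasDerivAt t (hw t)
  let h : ℝ → Cl N := fun t =>
    NormedSpace.exp (t • (-q)) * V (w t) * NormedSpace.exp (t • q)
  have hh : ∀ t, HasDerivAt h 0 t := by
    intro t
    have h1 := ((hasDerivAt_exp_smul_const (𝕂 := ℝ) (-q) t).mul (hV t)).mul
      (hasDerivAt_exp_smul_const' (𝕂 := ℝ) q t)
    refine h1.congr_deriv ?_
    have hc : V (L (w t)) = q * V (w t) - V (w t) * q :=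
      (quadElt_commutator_vec A hA (w t)).symm
    rw [hc]
    simp only [Pi.mul_apply]
    noncomm_ring
  have hconst : h 1 = h 0 :=
    is_const_of_deriv_eq_zero (fun t => (hh t).differentiableAt) (fun t => (hh t).deriv) 1 0
  simp only [h, one_smul, zero_smul, NormedSpace.exp_zero, one_mul, mul_one, w] at hconst
  have e1 : NormedSpace.exp q * NormedSpace.exp (-q) = 1 := by
    rw [← NormedSpace.exp_add_of_commute (Commute.neg_right (Commute.refl q))]; simp
  refine ⟨NormedSpace.exp L v, ?_⟩
  have hconst' : NormedSpace.exp (-q) * vec (NormedSpace.exp L v) * NormedSpace.exp q = vec v := by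
    have h0 : (0 : ℝ) • L = 0 := zero_smul ℝ L
    have h1 : NormedSpace.exp ((0 : ℝ) • L) = 1 :=
      (congrArg NormedSpace.exp h0).trans NormedSpace.exp_zero
    rw [h1] at hconst
    exact hconst
  rw [← hconst']
  calc _ = (NormedSpace.exp q * NormedSpace.exp (-q)) * vec (NormedSpace.exp L v) *
        (NormedSpace.exp q * NormedSpace.exp (-q)) := by noncomm_ring
    _ = _ := by rw [e1, one_mul, mul_one]

theorem exp_quadElt_mem_spinGroup [NeZero N] (X : so N) :
    NormedSpace.exp (quadElt N X) ∈ spinGroup (negForm N) := by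
  let _ : NormedAlgebra ℚ (Cl N) := NormedAlgebra.restrictScalars ℚ ℝ (Cl N)
  have hstar : star (NormedSpace.exp (quadElt N X)) = NormedSpace.exp (-quadElt N X) := by
    rw [NormedSpace.star_exp, star_quadElt, so_transpose, map_neg]
  have hc : Commute (quadElt N (X : Matrix (Fin N) (Fin N) ℝ)) (-quadElt N X) :=
    Commute.neg_right (Commute.refl _)
  rw [mem_spinGroup_iff (NeZero.pos N), hstar]
  refine ⟨exp_mem_even _ (quadElt_mem_even _), ?_, ?_, fun v => ?_⟩
  · rw [← NormedSpace.exp_add_of_commute hc.symm]; simp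
  · rw [← NormedSpace.exp_add_of_commute hc]; simp
  · obtain ⟨w, hw⟩ := exp_quadElt_conj (X : Matrix (Fin N) (Fin N) ℝ) (so_transpose X) v
    exact ⟨w, hw.symm⟩

/-- The isomorphism of `𝔰𝔬(N)` with the Lie algebra of `Spin(N)` inside the Clifford algebra,
`X ↦ -(1/4) ∑ X_{jk} e_j e_k`: the inverse of the differential of the covering
`Spin(N) → SO(N)`, `g ↦ (v ↦ g v g⁻¹)`. -/
noncomputable def soToCl (N : ℕ) : so N →ₗ⁅ℝ⁆ Cl N where
  toLinearMap := quadElt N ∘ₗ (so N).toSubmodule.subtype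
  map_lie' {X Y} := by
    change quadElt N (X.1 * Y.1 - Y.1 * X.1) = _
    rw [← quadElt_commutator _ _ (so_transpose X)]
    rfl

/-- The exponential map `𝔰𝔬(N) → Spin(N)`. -/
noncomputable def spinExp {N : ℕ} [NeZero N] (X : so N) : Spin N :=
  ⟨NormedSpace.exp (soToCl N X), exp_quadElt_mem_spinGroup X⟩

end Exponential

section ExteriorBasis

variable {I V : Type*} [LinearOrder I] [AddCommGroup V] [Module ℂ V] (b : Module.Basis I ℂ V)

/-- The interior product on the exterior algebra. -/
noncomputable def interior : Module.Dual ℂ V →ₗ[ℂ] ExteriorAlgebra ℂ V →ₗ[ℂ] ExteriorAlgebra ℂ V :=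
  contractLeft (Q := (0 : QuadraticForm ℂ V))

theorem interior_ι_mul (d : Module.Dual ℂ V) (a : V) (x : ExteriorAlgebra ℂ V) :
    interior d (ExteriorAlgebra.ι ℂ a * x) = d a • x - ExteriorAlgebra.ι ℂ a * interior d x :=
  contractLeft_ι_mul (Q := (0 : QuadraticForm ℂ V)) d a x

theorem interior_one (d : Module.Dual ℂ V) : interior d (1 : ExteriorAlgebra ℂ V) = 0 :=
  contractLeft_one (Q := (0 : QuadraticForm ℂ V)) d

theorem exteriorBasis_singleton (i : I) :
    b.ExteriorAlgebra {i} = ExteriorAlgebra.ι ℂ (b i) := by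
  rw [ExteriorAlgebra.basis_apply_ofCard b (Finset.card_singleton i),
    ExteriorAlgebra.ιMulti_family, ExteriorAlgebra.ιMulti_apply]
  simp only [List.ofFn_succ, List.ofFn_zero, List.prod_cons, List.prod_nil, mul_one]
  have h : Set.powersetCard.ofFinEmbEquiv.symm
      (Set.powersetCard.ofCard (Finset.card_singleton i)) 0 ∈ ({i} : Finset I) :=
    (Set.powersetCard.mem_range_ofFinEmbEquiv_symm_iff_mem
      (Set.powersetCard.ofCard (Finset.card_singleton i)) _).mp ⟨0, rfl⟩
  rw [Finset.mem_singleton] at h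
  rw [Function.comp_apply, h]

theorem ι_mul_exteriorBasis_of_mem (i : I) (S : Finset I) (hi : i ∈ S) :
    ExteriorAlgebra.ι ℂ (b i) * b.ExteriorAlgebra S = 0 := by
  have h := ExteriorAlgebra.basis_mul_of_not_disjoint b
    (Set.powersetCard.ofCard (s := {i}) (Finset.card_singleton i))
    (Set.powersetCard.ofCard (s := S) rfl) (by simpa using hi)
  simpa only [Set.powersetCard.val_ofCard, exteriorBasis_singleton] using h

theorem ι_mul_exteriorBasis (i : I) (S : Finset I) (hi : i ∉ S) :
    ∃ σ : ℤˣ, ExteriorAlgebra.ι ℂ (b i) * b.ExteriorAlgebra S =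
      ((σ : ℤ) : ℂ) • b.ExteriorAlgebra (insert i S) := by
  have hd : Disjoint (Set.powersetCard.ofCard (s := {i}) (Finset.card_singleton i)).val
    (Set.powersetCard.ofCard (s := S) rfl).val := by simpa using hi
  have h := ExteriorAlgebra.basis_mul_of_disjoint b
    (Set.powersetCard.ofCard (s := {i}) (Finset.card_singleton i))
    (Set.powersetCard.ofCard (s := S) rfl) hd
  have h2 : (Set.powersetCard.disjUnion hd : Finset I) = insert i S := by
    ext a; simp [Set.powersetCard.coe_disjUnion]
  simp only [Set.powersetCard.val_ofCard, exteriorBasis_singleton] at h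
  rw [h2] at h
  refine ⟨Equiv.Perm.sign (Set.powersetCard.permOfDisjoint hd), h.trans ?_⟩
  rw [Int.cast_smul_eq_zsmul]
  rfl

theorem interior_exteriorBasis_of_notMem (i : I) (S : Finset I) (hi : i ∉ S) :
    interior (b.coord i) (b.ExteriorAlgebra S) = 0 := by
  have key : ∀ l : List V, (∀ v ∈ l, b.coord i v = 0) →
      interior (b.coord i) (l.map (ExteriorAlgebra.ι ℂ)).prod = 0 := by
    intro l
    induction l with
    | nil => intro _; simpa using interior_one _
    | cons v l ih =>
      intro h
      rw [List.map_cons, List.prod_cons, interior_ι_mul, h v List.mem_cons_self,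
        ih fun w hw => h w (List.mem_cons_of_mem _ hw), zero_smul, mul_zero, sub_zero]
  rw [ExteriorAlgebra.basis_apply_ofCard b (rfl : S.card = S.card),
    ExteriorAlgebra.ιMulti_family, ExteriorAlgebra.ιMulti_apply]
  rw [show (fun j => ExteriorAlgebra.ι ℂ ((b ∘ (Set.powersetCard.ofFinEmbEquiv.symm
    (Set.powersetCard.ofCard (rfl : S.card = S.card)))) j)) = ExteriorAlgebra.ι ℂ ∘
    (b ∘ (Set.powersetCard.ofFinEmbEquiv.symm
    (Set.powersetCard.ofCard (rfl : S.card = S.card)))) from rfl, ← List.map_ofFn]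
  refine key _ fun v hv => ?_
  obtain ⟨j, rfl⟩ := (List.mem_ofFn' _ _).mp hv
  have hj := (Set.powersetCard.mem_range_ofFinEmbEquiv_symm_iff_mem
    (Set.powersetCard.ofCard (rfl : S.card = S.card)) _).mp ⟨j, rfl⟩
  rw [Function.comp_apply, Module.Basis.coord_apply, Module.Basis.repr_self,
    Finsupp.single_apply, if_neg]
  rintro h
  rw [h] at hj
  exact hi hj

end ExteriorBasis

section Fock

/-- The Fermionic Fock space, i.e. the exterior algebra `⋀ ℂⁿ`. -/
def Fock (n : ℕ) : Type := ExteriorAlgebra ℂ (EuclideanSpace ℂ (Fin n))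

noncomputable instance (n : ℕ) : Ring (Fock n) :=
  inferInstanceAs (Ring (ExteriorAlgebra ℂ (EuclideanSpace ℂ (Fin n))))

noncomputable instance (n : ℕ) : Algebra ℂ (Fock n) :=
  inferInstanceAs (Algebra ℂ (ExteriorAlgebra ℂ (EuclideanSpace ℂ (Fin n))))

variable {n : ℕ}

/-- The inclusion `ℂⁿ → ⋀ ℂⁿ`. -/
noncomputable def fockι : EuclideanSpace ℂ (Fin n) →ₗ[ℂ] Fock n := ExteriorAlgebra.ι ℂ

/-- The basis `e_S = e_{s₁} ∧ ⋯ ∧ e_{s_k}`, `S = {s₁ < ⋯ < s_k}`, of the Fock space. -/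
noncomputable def fockBasis (n : ℕ) : Module.Basis (Finset (Fin n)) ℂ (Fock n) :=
  (EuclideanSpace.basisFun (Fin n) ℂ).toBasis.ExteriorAlgebra

/-- The interior product on the Fock space. -/
noncomputable def fockInterior (d : Module.Dual ℂ (EuclideanSpace ℂ (Fin n))) :
    Fock n →ₗ[ℂ] Fock n := interior d

theorem fockInterior_ι_mul (d : Module.Dual ℂ (EuclideanSpace ℂ (Fin n)))
    (a : EuclideanSpace ℂ (Fin n)) (x : Fock n) :
    fockInterior d (fockι a * x) = d a • x - fockι a * fockInterior d x :=
  interior_ι_mul d a x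

/-- The Hermitian scalar product on the Fock space, antilinear in the left component, for which the
`e_S` are orthonormal; equivalently
`(v₁ ∧ ⋯ ∧ v_k, w₁ ∧ ⋯ ∧ w_k) = det (v_i, w_j)`, and different degrees are orthogonal. -/
noncomputable instance instCoreFock (n : ℕ) : InnerProductSpace.Core ℂ (Fock n) where
  inner ψ φ := ∑ S, (starRingEnd ℂ) ((fockBasis n).repr ψ S) * (fockBasis n).repr φ S
  conj_inner_symm ψ φ := by
    simp [map_sum, mul_comm]
  add_left ψ φ χ := by
    simp [add_mul, Finset.sum_add_distrib]
  smul_left ψ φ c := by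
    simp [mul_assoc, Finset.mul_sum]
  re_inner_nonneg ψ := by
    simp only [Complex.conj_mul', map_sum]
    exact Finset.sum_nonneg fun S _ => by
      rw [← Complex.ofReal_pow]; exact sq_nonneg _
  definite ψ h := by
    simp only [Complex.conj_mul'] at h
    have h' : ∑ S, ‖(fockBasis n).repr ψ S‖ ^ 2 = 0 := by exact_mod_cast h
    rw [Finset.sum_eq_zero_iff_of_nonneg fun _ _ => sq_nonneg _] at h'
    refine (fockBasis n).ext_elem fun S => ?_
    simpa using h' S (Finset.mem_univ S)

noncomputable instance (n : ℕ) : NormedAddCommGroup (Fock n) :=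
  InnerProductSpace.Core.toNormedAddCommGroup (𝕜 := ℂ)

noncomputable instance (n : ℕ) : InnerProductSpace ℂ (Fock n) := InnerProductSpace.ofCore _

instance (n : ℕ) : FiniteDimensional ℂ (Fock n) := Module.Finite.of_basis (fockBasis n)

theorem fock_inner_def (ψ φ : Fock n) :
    inner ℂ ψ φ = ∑ S, (starRingEnd ℂ) ((fockBasis n).repr ψ S) * (fockBasis n).repr φ S := rfl

theorem fock_inner_basis (S T : Finset (Fin n)) :
    inner ℂ (fockBasis n S) (fockBasis n T) = if S = T then (1 : ℂ) else 0 := by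
  rw [fock_inner_def]
  simp only [Module.Basis.repr_self, Finsupp.single_apply]
  rw [Finset.sum_eq_single S]
  · by_cases h : S = T
    · simp [h]
    · simp [h, Ne.symm h]
  · intro U _ hU; simp [Ne.symm hU]
  · simp

theorem fock_basis_adjoint (i : Fin n) (S T : Finset (Fin n)) :
    inner ℂ (fockInterior ((EuclideanSpace.basisFun (Fin n) ℂ).toBasis.coord i) (fockBasis n S))
      (fockBasis n T) =
    inner ℂ (fockBasis n S) (fockι (EuclideanSpace.single i 1) * fockBasis n T) := by
  set b := (EuclideanSpace.basisFun (Fin n) ℂ).toBasis with hb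
  have hbi : EuclideanSpace.single i (1 : ℂ) = b i := by simp [hb]
  have m0 : ∀ U : Finset (Fin n), i ∈ U →
      fockι (EuclideanSpace.single i 1) * fockBasis n U = 0 := by
    intro U hU; rw [hbi]; exact ι_mul_exteriorBasis_of_mem b i U hU
  have m1 : ∀ U : Finset (Fin n), i ∉ U → ∃ σ : ℤˣ,
      fockι (EuclideanSpace.single i 1) * fockBasis n U = ((σ : ℤ) : ℂ) •
        fockBasis n (insert i U) := by
    intro U hU; rw [hbi]; exact ι_mul_exteriorBasis b i U hU
  have c0 : ∀ U : Finset (Fin n), i ∉ U → fockInterior (b.coord i) (fockBasis n U) = 0 :=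
    fun U hU => interior_exteriorBasis_of_notMem b i U hU
  have hσ : ∀ σ : ℤˣ, ((σ : ℤ) : ℂ) * ((σ : ℤ) : ℂ) = 1 := by
    intro σ; rw [← Int.cast_mul, ← Units.val_mul, Int.units_mul_self]; simp
  have c1 : ∀ (U : Finset (Fin n)) (σ : ℤˣ), i ∉ U →
      fockι (EuclideanSpace.single i 1) * fockBasis n U = ((σ : ℤ) : ℂ) •
        fockBasis n (insert i U) →
      fockInterior (b.coord i) (fockBasis n (insert i U)) = ((σ : ℤ) : ℂ) • fockBasis n U := by
    intro U σ hU h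
    have h2 : fockBasis n (insert i U) =
        ((σ : ℤ) : ℂ) • (fockι (EuclideanSpace.single i 1) * fockBasis n U) := by
      rw [h, smul_smul, hσ, one_smul]
    rw [h2, map_smul, fockInterior_ι_mul, c0 U hU, mul_zero, sub_zero, hbi]
    simp
  by_cases hT : i ∈ T
  · rw [m0 T hT, inner_zero_right]
    by_cases hS : i ∈ S
    · obtain ⟨U, hU, rfl⟩ : ∃ U, i ∉ U ∧ S = insert i U :=
        ⟨S.erase i, by simp, (Finset.insert_erase hS).symm⟩
      obtain ⟨σ, h⟩ := m1 U hU
      rw [c1 U σ hU h, inner_smul_left, fock_inner_basis, if_neg, mul_zero]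
      rintro rfl; exact hU hT
    · rw [c0 S hS, inner_zero_left]
  · obtain ⟨σ, h⟩ := m1 T hT
    rw [h, inner_smul_right, fock_inner_basis]
    by_cases hS : i ∈ S
    · obtain ⟨U, hU, rfl⟩ : ∃ U, i ∉ U ∧ S = insert i U :=
        ⟨S.erase i, by simp, (Finset.insert_erase hS).symm⟩
      obtain ⟨τ, h'⟩ := m1 U hU
      rw [c1 U τ hU h', inner_smul_left, fock_inner_basis]
      by_cases hUT : U = T
      · subst hUT
        have : ((σ : ℤ) : ℂ) = ((τ : ℤ) : ℂ) :=
          smul_left_injective ℂ ((fockBasis n).ne_zero (insert i U)) (h.symm.trans h')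
        simp [this]
      · have : insert i U ≠ insert i T := fun e => hUT (by
          rw [← Finset.erase_insert hU, e, Finset.erase_insert hT])
        simp [hUT, this]
    · rw [c0 S hS, inner_zero_left, if_neg, mul_zero]
      rintro rfl; exact hS (Finset.mem_insert_self _ _)

end Fock

section Fields

variable {n : ℕ}

/-- The creation operators `c†(v) ψ = v ∧ ψ`. -/
noncomputable def creation (n : ℕ) : EuclideanSpace ℂ (Fin n) →ₗ[ℂ] Module.End ℂ (Fock n) :=
  (LinearMap.mul ℂ (Fock n)) ∘ₗ fockι

/-- The annihilation operators `c(v)`, the Hilbert space adjoints of the `c†(v)`. -/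
noncomputable def annihilation (n : ℕ) :
    EuclideanSpace ℂ (Fin n) →ₗ⋆[ℂ] Module.End ℂ (Fock n) :=
  { toFun := fun v => LinearMap.adjoint (creation n v)
    map_add' := fun v w => by rw [map_add, map_add]
    map_smul' := fun c v => by rw [map_smul, LinearEquiv.map_smulₛₗ] }

theorem creation_apply (v : EuclideanSpace ℂ (Fin n)) (ψ : Fock n) :
    creation n v ψ = fockι v * ψ := rfl

theorem annihilation_eq_adjoint (v : EuclideanSpace ℂ (Fin n)) :
    annihilation n v = LinearMap.adjoint (creation n v) := rfl

theorem annihilation_single (i : Fin n) :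
    annihilation n (EuclideanSpace.single i 1) =
      fockInterior ((EuclideanSpace.basisFun (Fin n) ℂ).toBasis.coord i) := by
  symm
  rw [annihilation_eq_adjoint, LinearMap.eq_adjoint_iff_basis (fockBasis n) (fockBasis n)]
  intro S T
  exact fock_basis_adjoint i S T

theorem eq_sum_single (v : EuclideanSpace ℂ (Fin n)) :
    v = ∑ i, v i • EuclideanSpace.single i (1 : ℂ) := by
  conv_lhs => rw [← (EuclideanSpace.basisFun (Fin n) ℂ).sum_repr v]
  simp

/-- Canonical anticommutation relations. -/
theorem annihilation_mul_creation (v w : EuclideanSpace ℂ (Fin n)) :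
    annihilation n w * creation n v + creation n v * annihilation n w =
      (inner ℂ w v : ℂ) • (1 : Module.End ℂ (Fock n)) := by
  have h : ∀ i, annihilation n (EuclideanSpace.single i 1) * creation n v +
      creation n v * annihilation n (EuclideanSpace.single i 1) =
      (v i) • (1 : Module.End ℂ (Fock n)) := by
    intro i
    rw [annihilation_single]
    ext ψ
    simp only [LinearMap.add_apply, Module.End.mul_apply, creation_apply, fockInterior_ι_mul,
      LinearMap.smul_apply, Module.End.one_apply, sub_add_cancel]
    simp
  rw [eq_sum_single w, map_sum, Finset.sum_mul, Finset.mul_sum, ← Finset.sum_add_distrib,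
    sum_inner, Finset.sum_smul]
  refine Finset.sum_congr rfl fun i _ => ?_
  rw [LinearMap.map_smulₛₗ, smul_mul_assoc, mul_smul_comm, ← smul_add, h, smul_smul,
    inner_smul_left, EuclideanSpace.inner_single_left, map_one, one_mul]

theorem creation_sq (v : EuclideanSpace ℂ (Fin n)) : creation n v * creation n v = 0 := by
  ext ψ
  rw [Module.End.mul_apply, creation_apply, creation_apply, ← mul_assoc]
  have : (fockι v : Fock n) * fockι v = 0 := ExteriorAlgebra.ι_sq_zero v
  rw [this, zero_mul]; rfl

theorem annihilation_sq (v : EuclideanSpace ℂ (Fin n)) :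
    annihilation n v * annihilation n v = 0 := by
  rw [annihilation_eq_adjoint]
  have := LinearMap.adjoint_comp (creation n v) (creation n v)
  change LinearMap.adjoint (creation n v) ∘ₗ LinearMap.adjoint (creation n v) = 0
  rw [← this]
  change LinearMap.adjoint (creation n v * creation n v) = 0
  rw [creation_sq, map_zero]

/-- The projection `ℝ²ⁿ → ℝⁿ ⊆ ℂⁿ`, `e_{2j-1} ↦ e_j`, `e_{2j} ↦ 0` (with indices from `1`). -/
noncomputable def projOdd (n : ℕ) :
    EuclideanSpace ℝ (Fin (2 * n)) →ₗ[ℝ] EuclideanSpace ℂ (Fin n) where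
  toFun v := WithLp.toLp 2 fun j => ((v ⟨2 * j, by omega⟩ : ℝ) : ℂ)
  map_add' v w := by ext j; simp
  map_smul' c v := by ext j; simp

/-- The projection `ℝ²ⁿ → ℝⁿ ⊆ ℂⁿ`, `e_{2j} ↦ e_j`, `e_{2j-1} ↦ 0` (with indices from `1`). -/
noncomputable def projEven (n : ℕ) :
    EuclideanSpace ℝ (Fin (2 * n)) →ₗ[ℝ] EuclideanSpace ℂ (Fin n) where
  toFun v := WithLp.toLp 2 fun j => ((v ⟨2 * j + 1, by omega⟩ : ℝ) : ℂ)
  map_add' v w := by ext j; simp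
  map_smul' c v := by ext j; simp

/-- The Fock representation of vectors of `ℝ²ⁿ`,
`γ(v) = c†(P₁ v) - c(P₁ v) - i (c†(P₂ v) + c(P₂ v))`. -/
noncomputable def gamma (n : ℕ) : EuclideanSpace ℝ (Fin (2 * n)) →ₗ[ℝ] Module.End ℂ (Fock n) where
  toFun v := creation n (projOdd n v) - annihilation n (projOdd n v) -
    Complex.I • (creation n (projEven n v) + annihilation n (projEven n v))
  map_add' v w := by
    simp only [map_add, smul_add]; abel
  map_smul' c v := by
    have h1 : ∀ x : EuclideanSpace ℂ (Fin n), c • x = (c : ℂ) • x := fun x => rfl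
    have h2 : ∀ x : Module.End ℂ (Fock n), c • x = (c : ℂ) • x := fun x => rfl
    simp only [map_smul, h1, h2, LinearMap.map_smulₛₗ, Complex.conj_ofReal, RingHom.id_apply,
      smul_sub, smul_add]
    simp only [smul_comm (c : ℂ) Complex.I]

theorem gamma_apply (v : EuclideanSpace ℝ (Fin (2 * n))) :
    gamma n v = creation n (projOdd n v) - annihilation n (projOdd n v) -
    Complex.I • (creation n (projEven n v) + annihilation n (projEven n v)) := rfl

theorem sum_fin_two_mul (f : Fin (2 * n) → ℝ) :
    ∑ i, f i = ∑ j : Fin n, (f ⟨2 * j, by omega⟩ + f ⟨2 * j + 1, by omega⟩) := by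
  let g : ℕ → ℝ := fun i => if h : i < 2 * n then f ⟨i, h⟩ else 0
  have h1 : ∑ i, f i = ∑ i ∈ Finset.range (2 * n), g i := by
    rw [← Fin.sum_univ_eq_sum_range]
    exact Finset.sum_congr rfl fun i _ => by simp [g]
  have h2 : ∑ j : Fin n, (f ⟨2 * j, by omega⟩ + f ⟨2 * j + 1, by omega⟩) =
      ∑ j ∈ Finset.range n, (g (2 * j) + g (2 * j + 1)) := by
    rw [← Fin.sum_univ_eq_sum_range (fun j => g (2 * j) + g (2 * j + 1))]
    refine Finset.sum_congr rfl fun j _ => ?_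
    have hj := j.2
    have e1 : 2 * (j : ℕ) < 2 * n := by omega
    have e2 : 2 * (j : ℕ) + 1 < 2 * n := by omega
    simp [g, e2]
  rw [h1, h2]
  generalize n = m
  induction m with
  | zero => simp
  | succ m ih =>
    rw [Finset.sum_range_succ, ← ih, show 2 * (m + 1) = 2 * m + 1 + 1 by ring,
      Finset.sum_range_succ, Finset.sum_range_succ, add_assoc]

theorem gamma_sq (v : EuclideanSpace ℝ (Fin (2 * n))) :
    gamma n v * gamma n v = (-(‖v‖ ^ 2 : ℝ) : ℂ) • (1 : Module.End ℂ (Fock n)) := by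
  set a := projOdd n v with ha
  set b := projEven n v with hb
  have haa := annihilation_mul_creation a a
  have hbb := annihilation_mul_creation b b
  have hab := annihilation_mul_creation a b
  have hba := annihilation_mul_creation b a
  have hsym : (inner ℂ b a : ℂ) = inner ℂ a b := by
    simp [ha, hb, projOdd, projEven, PiLp.inner_apply, mul_comm]
  have hcc : creation n a * creation n b = -(creation n b * creation n a) := by
    have := creation_sq (a + b)
    rw [map_add, add_mul, mul_add, mul_add, creation_sq, creation_sq] at this
    simpa using eq_neg_of_add_eq_zero_left (by simpa using this)
  have hdd : annihilation n a * annihilation n b = -(annihilation n b * annihilation n a) := by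
    have := annihilation_sq (a + b)
    rw [map_add, add_mul, mul_add, mul_add, annihilation_sq, annihilation_sq] at this
    simpa using eq_neg_of_add_eq_zero_left (by simpa using this)
  have hnorm : ((‖v‖ ^ 2 : ℝ) : ℂ) = inner ℂ a a + inner ℂ b b := by
    rw [EuclideanSpace.norm_sq_eq, sum_fin_two_mul]
    simp only [ha, hb, projOdd, projEven, PiLp.inner_apply, LinearMap.coe_mk, AddHom.coe_mk]
    rw [← Finset.sum_add_distrib]
    push_cast
    refine Finset.sum_congr rfl fun j _ => ?_
    simp [sq, ← Complex.ofReal_mul]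
  have hA : (creation n a - annihilation n a) * (creation n a - annihilation n a) =
      -((inner ℂ a a : ℂ) • (1 : Module.End ℂ (Fock n))) := by
    rw [← haa, sub_mul, mul_sub, mul_sub, creation_sq, annihilation_sq]; abel
  have hB : (creation n b + annihilation n b) * (creation n b + annihilation n b) =
      (inner ℂ b b : ℂ) • (1 : Module.End ℂ (Fock n)) := by
    rw [← hbb, add_mul, mul_add, mul_add, creation_sq, annihilation_sq]; abel
  have hAB : (creation n a - annihilation n a) * (creation n b + annihilation n b) +
      (creation n b + annihilation n b) * (creation n a - annihilation n a) = 0 := by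
    have e : annihilation n b * creation n a + creation n a * annihilation n b =
        annihilation n a * creation n b + creation n b * annihilation n a := by
      rw [hab, hba, hsym]
    have e' : creation n a * annihilation n b = annihilation n a * creation n b +
      creation n b * annihilation n a - annihilation n b * creation n a := by rw [← e]; abel
    simp only [sub_mul, mul_add, add_mul, mul_sub]
    rw [hcc, hdd, e']
    abel
  rw [gamma_apply, ← ha, ← hb]
  set A := creation n a - annihilation n a
  set B := creation n b + annihilation n b
  have : (A - Complex.I • B) * (A - Complex.I • B) =
      A * A - B * B - Complex.I • (A * B + B * A) := by
    have hI : Complex.I • Complex.I • (B * B) = -(B * B) := by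
      rw [smul_smul, Complex.I_mul_I, neg_smul, one_smul]
    simp only [sub_mul, mul_sub, smul_mul_assoc, mul_smul_comm, smul_add, smul_sub, hI]
    abel
  rw [this, hA, hB, hAB, smul_zero, sub_zero]
  have hn : ((‖v‖ : ℂ)) ^ 2 = inner ℂ a a + inner ℂ b b := by rw [← hnorm]; push_cast; rfl
  push_cast
  rw [hn, neg_smul, add_smul]
  abel

end Fields

section SpinRep

variable {n : ℕ}

/-- The first `2n` coordinates of a vector of `ℝ²ⁿ⁺¹`. -/
noncomputable def initVec (n : ℕ) :
    EuclideanSpace ℝ (Fin (2 * n + 1)) →ₗ[ℝ] EuclideanSpace ℝ (Fin (2 * n)) where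
  toFun v := WithLp.toLp 2 fun j => v j.castSucc
  map_add' v w := by ext j; simp
  map_smul' c v := by ext j; simp

/-- The last coordinate of a vector of `ℝ²ⁿ⁺¹`, as a scalar operator on the Fock space. -/
noncomputable def lastOp (n : ℕ) :
    EuclideanSpace ℝ (Fin (2 * n + 1)) →ₗ[ℝ] Module.End ℂ (Fock n) where
  toFun v := ((v (Fin.last (2 * n)) : ℝ) : ℂ) • (1 : Module.End ℂ (Fock n))
  map_add' v w := by simp [add_smul]
  map_smul' c v := by
    have h2 : ∀ x : Module.End ℂ (Fock n), c • x = (c : ℂ) • x := fun x => rfl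
    rw [RingHom.id_apply, h2, smul_smul, PiLp.smul_apply, smul_eq_mul, Complex.ofReal_mul]

/-- The bilinear map `(v, w) ↦ (γ(v') + v_N) (γ(w') - w_N)`, for `N = 2n+1` and
`v = v' + v_N e_N`; it describes the algebra homomorphism from the even Clifford algebra of `ℝ²ⁿ⁺¹`
to the operators on the Fock space given by `e_N e_j ↦ γ_j`, `e_j e_k ↦ γ_j γ_k`,
`j, k ≤ 2n`. -/
noncomputable def evenBilin (n : ℕ) : EuclideanSpace ℝ (Fin (2 * n + 1)) →ₗ[ℝ]
    EuclideanSpace ℝ (Fin (2 * n + 1)) →ₗ[ℝ] Module.End ℂ (Fock n) :=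
  (LinearMap.mul ℝ (Module.End ℂ (Fock n))).compl₁₂
    (gamma n ∘ₗ initVec n + lastOp n) (gamma n ∘ₗ initVec n - lastOp n)

theorem evenBilin_apply (v w : EuclideanSpace ℝ (Fin (2 * n + 1))) :
    evenBilin n v w = (gamma n (initVec n v) +
      ((v (Fin.last (2 * n)) : ℝ) : ℂ) • (1 : Module.End ℂ (Fock n))) *
      (gamma n (initVec n w) -
        ((w (Fin.last (2 * n)) : ℝ) : ℂ) • (1 : Module.End ℂ (Fock n))) := rfl

theorem norm_sq_initVec (v : EuclideanSpace ℝ (Fin (2 * n + 1))) :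
    ‖v‖ ^ 2 = ‖initVec n v‖ ^ 2 + v (Fin.last (2 * n)) ^ 2 := by
  simp [EuclideanSpace.norm_sq_eq, Fin.sum_univ_castSucc, initVec]

theorem gamma_diff (v : EuclideanSpace ℝ (Fin (2 * n + 1))) :
    (gamma n (initVec n v) +
      ((v (Fin.last (2 * n)) : ℝ) : ℂ) • (1 : Module.End ℂ (Fock n))) *
      (gamma n (initVec n v) -
        ((v (Fin.last (2 * n)) : ℝ) : ℂ) • (1 : Module.End ℂ (Fock n))) =
    ((negForm (2 * n + 1) v : ℝ) : ℂ) • (1 : Module.End ℂ (Fock n)) ∧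
    (gamma n (initVec n v) -
      ((v (Fin.last (2 * n)) : ℝ) : ℂ) • (1 : Module.End ℂ (Fock n))) *
      (gamma n (initVec n v) +
        ((v (Fin.last (2 * n)) : ℝ) : ℂ) • (1 : Module.End ℂ (Fock n))) =
    ((negForm (2 * n + 1) v : ℝ) : ℂ) • (1 : Module.End ℂ (Fock n)) := by
  have h := gamma_sq (initVec n v)
  have key : ∀ (G : Module.End ℂ (Fock n)) (c s : ℂ), G * G = s • (1 : Module.End ℂ (Fock n)) →
      (G + c • (1 : Module.End ℂ (Fock n))) * (G - c • (1 : Module.End ℂ (Fock n))) =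
        (s - c * c) • (1 : Module.End ℂ (Fock n)) := by
    intro G c s h
    simp only [mul_sub, add_mul, h, smul_mul_assoc, mul_smul_comm, mul_one, one_mul,
      sub_smul]
    module
  have hs : ((negForm (2 * n + 1) v : ℝ) : ℂ) = (-(‖initVec n v‖ ^ 2 : ℝ) : ℂ) -
      ((v (Fin.last (2 * n)) : ℝ) : ℂ) * ((v (Fin.last (2 * n)) : ℝ) : ℂ) := by
    rw [negForm_apply, norm_sq_initVec]; push_cast; ring
  rw [hs]
  refine ⟨key _ _ _ h, ?_⟩
  have h' := key (gamma n (initVec n v)) (-((v (Fin.last (2 * n)) : ℝ) : ℂ)) _ h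
  rwa [neg_smul, sub_neg_eq_add, ← sub_eq_add_neg, neg_mul_neg] at h'

/-- The homomorphism from the even Clifford algebra to the operators on the Fock space. -/
noncomputable def evenRep (n : ℕ) :
    even (negForm (2 * n + 1)) →ₐ[ℝ] Module.End ℂ (Fock n) :=
  even.lift (negForm (2 * n + 1))
    { bilin := evenBilin n
      contract := fun v => by
        rw [evenBilin_apply, (gamma_diff v).1]; rfl
      contract_mid := fun u v w => by
        rw [evenBilin_apply, evenBilin_apply, evenBilin_apply, mul_assoc, ← mul_assoc _ _
          (gamma n (initVec n w) - _), (gamma_diff v).2, smul_mul_assoc, one_mul, mul_smul_comm]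
        rfl }

theorem evenRep_ι_mul_ι (v w : EuclideanSpace ℝ (Fin (2 * n + 1))) :
    evenRep n ⟨vec v * vec w, ι_mul_ι_mem_evenOdd_zero _ v w⟩ = evenBilin n v w :=
  even.lift_ι (negForm (2 * n + 1)) _ v w

/-- The `1/2`-spin representation `π^{1/2}` of `Spin(2n+1)` on the Fock space. -/
noncomputable def spinRep (n : ℕ) : Representation ℂ (Spin (2 * n + 1)) (Fock n) where
  toFun g := evenRep n ⟨g.1, spinGroup.mem_even g.2⟩
  map_one' := map_one (evenRep n)
  map_mul' g h := map_mul (evenRep n) ⟨g.1, spinGroup.mem_even g.2⟩ ⟨h.1, spinGroup.mem_even h.2⟩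

/-- The operators `γ_j = γ(e_j)`. -/
noncomputable def gammaE (n : ℕ) (j : Fin (2 * n)) : Module.End ℂ (Fock n) :=
  gamma n (EuclideanSpace.single j 1)

/-- The linear map underlying the `1/2`-spin representation of `𝔰𝔬(2n+1)`. -/
noncomputable def spinLieFun (n : ℕ) (X : so (2 * n + 1)) : Module.End ℂ (Fock n) :=
  (1 / 2 : ℝ) • ∑ j : Fin (2 * n), X.1 j.castSucc (Fin.last (2 * n)) • gammaE n j -
    (1 / 4 : ℝ) • ∑ j : Fin (2 * n), ∑ k : Fin (2 * n),
      X.1 j.castSucc k.castSucc • (gammaE n j * gammaE n k)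

theorem initVec_castSucc (j : Fin (2 * n)) :
    initVec n (EuclideanSpace.single j.castSucc 1) = EuclideanSpace.single j 1 := by
  ext k; simp [initVec]

theorem initVec_last : initVec n (EuclideanSpace.single (Fin.last (2 * n)) 1) = 0 := by
  ext k; simp [initVec, Fin.castSucc_ne_last]

theorem evenRep_quadElt (X : so (2 * n + 1)) (h : soToCl (2 * n + 1) X ∈ even (negForm (2 * n + 1))) :
    evenRep n ⟨soToCl (2 * n + 1) X, h⟩ = spinLieFun n X := by
  have hX : ∀ j k, X.1 j k = - X.1 k j := fun j k => by
    have := congrFun (congrFun (so_transpose X) k) j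
    simpa using this
  have e : (⟨soToCl (2 * n + 1) X, h⟩ : even (negForm (2 * n + 1))) =
      (-(1 / 4) : ℝ) • ∑ j, ∑ k, X.1 j k •
        (⟨vec (EuclideanSpace.single j 1) * vec (EuclideanSpace.single k 1),
          ι_mul_ι_mem_evenOdd_zero _ _ _⟩ : even (negForm (2 * n + 1))) := by
    apply Subtype.ext
    simp only [Subalgebra.coe_smul, AddSubmonoidClass.coe_finsetSum]
    rfl
  rw [e]
  simp only [map_smul, map_sum, evenRep_ι_mul_ι]
  have b1 : ∀ j k : Fin (2 * n), evenBilin n (EuclideanSpace.single j.castSucc 1)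
      (EuclideanSpace.single k.castSucc 1) = gammaE n j * gammaE n k := by
    intro j k
    simp [evenBilin_apply, initVec_castSucc, gammaE, (Fin.castSucc_ne_last _).symm]
  have b2 : ∀ j : Fin (2 * n), evenBilin n (EuclideanSpace.single j.castSucc 1)
      (EuclideanSpace.single (Fin.last (2 * n)) 1) = -gammaE n j := by
    intro j
    simp [evenBilin_apply, initVec_castSucc, initVec_last, gammaE, (Fin.castSucc_ne_last _).symm]
  have b3 : ∀ j : Fin (2 * n), evenBilin n (EuclideanSpace.single (Fin.last (2 * n)) 1)
      (EuclideanSpace.single j.castSucc 1) = gammaE n j := by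
    intro j
    simp [evenBilin_apply, initVec_castSucc, initVec_last, gammaE, (Fin.castSucc_ne_last _).symm]
  have hll : X.1 (Fin.last (2 * n)) (Fin.last (2 * n)) = 0 := by
    have := hX (Fin.last (2 * n)) (Fin.last (2 * n)); linarith
  simp only [Fin.sum_univ_castSucc, b1, b2, b3, hll, zero_smul, add_zero, Finset.sum_add_distrib]
  simp only [hX (Fin.last (2 * n)) _, neg_smul, smul_neg, Finset.sum_neg_distrib, spinLieFun]
  set S := ∑ j : Fin (2 * n), X.1 j.castSucc (Fin.last (2 * n)) • gammaE n j
  set T := ∑ j : Fin (2 * n), ∑ k : Fin (2 * n),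
      X.1 j.castSucc k.castSucc • (gammaE n j * gammaE n k)
  module

theorem soToCl_mem_even (X : so (2 * n + 1)) :
    soToCl (2 * n + 1) X ∈ even (negForm (2 * n + 1)) := quadElt_mem_even X.1

theorem spinLieFun_lie (X Y : so (2 * n + 1)) :
    spinLieFun n ⁅X, Y⁆ = ⁅spinLieFun n X, spinLieFun n Y⁆ := by
  have e : (⟨soToCl (2 * n + 1) ⁅X, Y⁆, soToCl_mem_even _⟩ : even (negForm (2 * n + 1))) =
      ⟨soToCl (2 * n + 1) X, soToCl_mem_even _⟩ * ⟨soToCl (2 * n + 1) Y, soToCl_mem_even _⟩ -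
      ⟨soToCl (2 * n + 1) Y, soToCl_mem_even _⟩ * ⟨soToCl (2 * n + 1) X, soToCl_mem_even _⟩ :=
    Subtype.ext (LieHom.map_lie (soToCl (2 * n + 1)) X Y)
  have h := congrArg (evenRep n) e
  rw [map_sub, map_mul, map_mul] at h
  simp only [evenRep_quadElt] at h
  exact h

/-- The `1/2`-spin representation `π^{1/2}` of `𝔰𝔬(2n+1)` on the Fock space,
`X_{j,2n+1} ↦ (1/2) γ_j`, `X_{jk} ↦ -(1/2) γ_j γ_k` for `j, k ≤ 2n`, where `X_{jk}` is the matrix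
with entry `1` in position `(j,k)`, entry `-1` in position `(k,j)` and zeros elsewhere. -/
noncomputable def spinLieRep (n : ℕ) : so (2 * n + 1) →ₗ⁅ℝ⁆ Module.End ℂ (Fock n) where
  toFun := spinLieFun n
  map_add' X Y := by
    have h : (X + Y).1 = X.1 + Y.1 := rfl
    simp only [spinLieFun, h, Matrix.add_apply, add_smul,
      Finset.sum_add_distrib, smul_add]
    abel
  map_smul' c X := by
    have h : (c • X).1 = c • X.1 := rfl
    simp only [spinLieFun, h, Matrix.smul_apply, smul_eq_mul, mul_smul,
      ← Finset.smul_sum, RingHom.id_apply, smul_sub]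
    simp only [smul_comm c]
  map_lie' {X Y} := spinLieFun_lie X Y

end SpinRep

section HaarMeasure

variable (N : ℕ) [NeZero N]

/-- The normalized Haar measure on `Spin(N)`. -/
noncomputable def spinHaar : Measure (Spin N) := Measure.haarMeasure ⊤

instance : (spinHaar N).IsHaarMeasure := by unfold spinHaar; infer_instance

instance : IsProbabilityMeasure (spinHaar N) :=
  ⟨Measure.haarMeasure_self (K₀ := (⊤ : TopologicalSpace.PositiveCompacts (Spin N)))⟩

instance : (spinHaar N).IsMulRightInvariant where
  map_mul_right_eq_self g := by
    have hc : Continuous fun x : Spin N => x * g := continuous_mul_const g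
    have h2 : IsProbabilityMeasure ((spinHaar N).map fun x => x * g) :=
      Measure.isProbabilityMeasure_map hc.aemeasurable
    have h1 : ((spinHaar N).map fun x => x * g).IsHaarMeasure :=
      Measure.isHaarMeasure_map_mul_right _ g
    exact Measure.isHaarMeasure_eq_of_isProbabilityMeasure _ _

/-- The Hilbert space `L²(Spin(N))` with respect to the normalized Haar measure. -/
abbrev L2Spin : Type := Lp ℂ 2 (spinHaar N)

/-- The right regular representation `(R(g) f)(x) = f(x g)` of `Spin(N)` on `L²(Spin(N))`. -/
noncomputable def rightRegular : Representation ℂ (Spin N) (L2Spin N) where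
  toFun g := Lp.compMeasurePreservingₗ ℂ (fun x => x * g) (measurePreserving_mul_right (spinHaar N) g)
  map_one' := by
    ext1 f
    refine Lp.ext ?_
    refine (Lp.coeFn_compMeasurePreserving f _).trans ?_
    simp [Function.comp_def]
  map_mul' g h := by
    ext1 f
    have e : ∀ k, MeasurePreserving (fun x => x * k) (spinHaar N) (spinHaar N) :=
      measurePreserving_mul_right (spinHaar N)
    change Lp.compMeasurePreserving _ (e (g * h)) f =
      Lp.compMeasurePreserving _ (e g) (Lp.compMeasurePreserving _ (e h) f)
    rw [← Lp.compMeasurePreserving_comp_apply]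
    have h2 : (fun x => x * (g * h)) = (fun x => x * h) ∘ fun x : Spin N => x * g := by
      ext x; simp [mul_assoc]
    congr 2

variable {N}

theorem memLp_of_continuous {f : Spin N → ℂ} (hf : Continuous f) : MemLp f 2 (spinHaar N) :=
  hf.memLp_of_hasCompactSupport (HasCompactSupport.of_compactSpace f)

end HaarMeasure

section Smooth

/-- The space `C^∞(Spin(N))` of complex valued smooth functions on `Spin(N)`. As `Spin(N)` is a closed
submanifold of the finite-dimensional vector space `Cl N`, a function on it is smooth if and only if
it is locally the restriction of a smooth function on `Cl N`. -/
def smoothFunctions (N : ℕ) : Submodule ℂ (Spin N → ℂ) where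
  carrier := {f | ∀ g : Spin N, ∃ U : Set (Cl N), IsOpen U ∧ (g : Cl N) ∈ U ∧
    ∃ F : Cl N → ℂ, ContDiff ℝ ∞ F ∧ ∀ x : Spin N, (x : Cl N) ∈ U → f x = F x}
  add_mem' {f₁ f₂} h₁ h₂ g := by
    obtain ⟨U₁, o₁, m₁, F₁, s₁, e₁⟩ := h₁ g
    obtain ⟨U₂, o₂, m₂, F₂, s₂, e₂⟩ := h₂ g
    refine ⟨U₁ ∩ U₂, o₁.inter o₂, ⟨m₁, m₂⟩, fun x => F₁ x + F₂ x, s₁.add s₂, fun x hx => ?_⟩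
    rw [Pi.add_apply, e₁ x hx.1, e₂ x hx.2]
  zero_mem' g := ⟨Set.univ, isOpen_univ, trivial, fun _ => 0, contDiff_const, fun _ _ => rfl⟩
  smul_mem' c f h g := by
    obtain ⟨U, o, m, F, s, e⟩ := h g
    refine ⟨U, o, m, fun x => c • F x, s.const_smul c, fun x hx => ?_⟩
    rw [Pi.smul_apply, e x hx]

variable {N : ℕ}

theorem mem_smoothFunctions {f : Spin N → ℂ} : f ∈ smoothFunctions N ↔
    ∀ g : Spin N, ∃ U : Set (Cl N), IsOpen U ∧ (g : Cl N) ∈ U ∧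
      ∃ F : Cl N → ℂ, ContDiff ℝ ∞ F ∧ ∀ x : Spin N, (x : Cl N) ∈ U → f x = F x := Iff.rfl

theorem continuous_of_smooth {f : Spin N → ℂ} (hf : f ∈ smoothFunctions N) : Continuous f := by
  rw [continuous_iff_continuousAt]
  intro g
  obtain ⟨U, o, m, F, s, e⟩ := hf g
  have h1 : ContinuousAt (fun x : Spin N => F x) g :=
    (s.continuous.comp continuous_subtype_val).continuousAt
  refine h1.congr ?_
  filter_upwards [(o.preimage continuous_subtype_val).mem_nhds m] with x hx
  exact (e x hx).symm

variable [NeZero N]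

/-- The embedding of `C^∞(Spin(N))` in `L²(Spin(N))`, mapping a function to its class. -/
noncomputable def smoothToL2 (N : ℕ) [NeZero N] : smoothFunctions N →ₗ[ℂ] L2Spin N where
  toFun f := (memLp_of_continuous (continuous_of_smooth f.2)).toLp f.1
  map_add' _ _ := MemLp.toLp_add _ _
  map_smul' c _ := MemLp.toLp_const_smul c _

theorem hasDerivAt_spinExp (g : Spin N) (X : so N) (F : Cl N → ℂ) (hF : ContDiff ℝ ∞ F) :
    HasDerivAt (fun t : ℝ => F ((g * spinExp (t • X) : Spin N) : Cl N))
      (fderiv ℝ F g (g * soToCl N X)) 0 := by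
  have h0 : HasDerivAt (fun t : ℝ => (g : Cl N) * NormedSpace.exp (t • soToCl N X))
      ((g : Cl N) * soToCl N X) 0 := by
    have := (hasDerivAt_exp_smul_const' (𝕂 := ℝ) (soToCl N X) 0).const_mul (g : Cl N)
    simpa [NormedSpace.exp_zero] using this
  have h1 : (fun t : ℝ => ((g * spinExp (t • X) : Spin N) : Cl N)) =
      fun t : ℝ => (g : Cl N) * NormedSpace.exp (t • soToCl N X) := by
    ext t
    simp [spinExp]
  have h2 := (hF.differentiable (by simp)).differentiableAt (x := (g : Cl N))
  have h3 : HasFDerivAt F (fderiv ℝ F g) ((g : Cl N) * NormedSpace.exp ((0 : ℝ) • soToCl N X)) := by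
    rw [zero_smul, NormedSpace.exp_zero, mul_one]; exact h2.hasFDerivAt
  have := h3.comp_hasDerivAt (0 : ℝ) h0
  have h4 := congrArg (fun G : ℝ → Cl N => fun t => F (G t)) h1
  change (fun t : ℝ => F ((g * spinExp (t • X) : Spin N) : Cl N)) = _ at h4
  rw [h4]
  exact this

theorem continuous_mul_spinExp (g : Spin N) (X : so N) :
    Continuous fun t : ℝ => g * spinExp (t • X) := by
  let _ : NormedAlgebra ℚ (Cl N) := NormedAlgebra.restrictScalars ℚ ℝ (Cl N)
  refine continuous_const.mul (Continuous.subtype_mk ?_ _)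
  simp only [map_smul]
  exact NormedSpace.exp_continuous.comp (by fun_prop)

theorem hasDerivAt_of_local {f : Spin N → ℂ} {g : Spin N} {U : Set (Cl N)} {F : Cl N → ℂ}
    (o : IsOpen U) (m : (g : Cl N) ∈ U) (s : ContDiff ℝ ∞ F)
    (e : ∀ x : Spin N, (x : Cl N) ∈ U → f x = F x) (X : so N) :
    HasDerivAt (fun t : ℝ => f (g * spinExp (t • X))) (fderiv ℝ F g (g * soToCl N X)) 0 := by
  refine (hasDerivAt_spinExp g X F s).congr_of_eventuallyEq ?_
  have hc : Continuous fun t : ℝ => ((g * spinExp (t • X) : Spin N) : Cl N) :=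
    continuous_subtype_val.comp (continuous_mul_spinExp g X)
  have h0 : ((g * spinExp ((0 : ℝ) • X) : Spin N) : Cl N) ∈ U := by
    simpa [spinExp, NormedSpace.exp_zero] using m
  filter_upwards [(o.preimage hc).mem_nhds h0] with t ht
  exact e _ ht

/-- The action `dR` of `𝔰𝔬(N)` on `C^∞(Spin(N))`,
`(dR(X) f)(g) = d/dt f(g e^{tX})` at `t = 0`. -/
noncomputable def dR (X : so N) : Module.End ℂ (smoothFunctions N) where
  toFun f := ⟨fun g => deriv (fun t : ℝ => f.1 (g * spinExp (t • X))) 0, by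
    intro g
    obtain ⟨U, o, m, F, s, e⟩ := f.2 g
    refine ⟨U, o, m, fun x => fderiv ℝ F x (x * soToCl N X), ?_, fun x hx => ?_⟩
    · exact (s.fderiv_right (by simp)).clm_apply (contDiff_id.mul contDiff_const)
    · exact (hasDerivAt_of_local o hx s e X).deriv⟩
  map_add' f₁ f₂ := by
    ext g
    obtain ⟨U₁, o₁, m₁, F₁, s₁, e₁⟩ := f₁.2 g
    obtain ⟨U₂, o₂, m₂, F₂, s₂, e₂⟩ := f₂.2 g
    exact deriv_fun_add (hasDerivAt_of_local o₁ m₁ s₁ e₁ X).differentiableAt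
      (hasDerivAt_of_local o₂ m₂ s₂ e₂ X).differentiableAt
  map_smul' c f := by
    ext g
    obtain ⟨U, o, m, F, s, e⟩ := f.2 g
    exact deriv_const_smul c (hasDerivAt_of_local o m s e X).differentiableAt

theorem dR_apply (X : so N) (f : smoothFunctions N) (g : Spin N) :
    (dR X f).1 g = deriv (fun t : ℝ => f.1 (g * spinExp (t • X))) 0 := rfl

end Smooth

section Embedding

/-- The spin representation of the Lie algebra is the differential of that of the group. -/
theorem hasDerivAt_spinRep (n : ℕ) (X : so (2 * n + 1)) (ψ : Fock n) :
    HasDerivAt (fun t : ℝ => spinRep n (spinExp (t • X)) ψ) (spinLieRep n X ψ) 0 := by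
  let l : even (negForm (2 * n + 1)) →ₗ[ℝ] Fock n :=
    { toFun := fun x => evenRep n x ψ
      map_add' := fun x y => by rw [map_add, LinearMap.add_apply]
      map_smul' := fun c x => by rw [map_smul]; rfl }
  obtain ⟨L, hL⟩ := LinearMap.exists_extend
    (p := Subalgebra.toSubmodule (even (negForm (2 * n + 1)))) l
  have hL' : ∀ x : even (negForm (2 * n + 1)), L x.1 = evenRep n x ψ := fun x =>
    congrArg (fun f => f x) hL
  have h0 : HasDerivAt (fun t : ℝ => NormedSpace.exp (t • soToCl (2 * n + 1) X))
      (soToCl (2 * n + 1) X) 0 := by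
    have := hasDerivAt_exp_smul_const' (𝕂 := ℝ) (soToCl (2 * n + 1) X) 0
    simpa [NormedSpace.exp_zero] using this
  have h1 := (LinearMap.toContinuousLinearMap L).hasFDerivAt.comp_hasDerivAt (0 : ℝ) h0
  have e1 : spinLieRep n X ψ = L (soToCl (2 * n + 1) X) := by
    rw [hL' ⟨soToCl (2 * n + 1) X, soToCl_mem_even X⟩, evenRep_quadElt]; rfl
  have e2 : (fun t : ℝ => spinRep n (spinExp (t • X)) ψ) =
      fun t : ℝ => L (NormedSpace.exp (t • soToCl (2 * n + 1) X)) := by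
    ext1 t
    rw [← map_smul]
    exact (hL' ⟨(spinExp (t • X)).1, spinGroup.mem_even (spinExp (t • X)).2⟩).symm
  rw [e1, e2]
  exact h1

/-- The matrix coefficient `g ↦ (1, π^{1/2}(g) ψ)` on `Spin(2n+1)`. -/
noncomputable def fockFun (n : ℕ) (ψ : Fock n) (g : Spin (2 * n + 1)) : ℂ :=
  inner ℂ (1 : Fock n) (spinRep n g ψ)

theorem continuous_fockFun (n : ℕ) (ψ : Fock n) : Continuous (fockFun n ψ) := by
  let l : even (negForm (2 * n + 1)) →ₗ[ℝ] ℂ :=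
    { toFun := fun x => inner ℂ (1 : Fock n) (evenRep n x ψ)
      map_add' := fun x y => by rw [map_add, LinearMap.add_apply, inner_add_right]
      map_smul' := fun c x => by
        rw [map_smul]
        exact inner_smul_right (𝕜 := ℂ) _ _ (c : ℂ) }
  have h : Continuous l := l.continuous_of_finiteDimensional
  exact h.comp (f := fun g : Spin (2 * n + 1) =>
    (⟨g.1, spinGroup.mem_even g.2⟩ : even (negForm (2 * n + 1))))
    (Continuous.subtype_mk continuous_subtype_val _)

/-- The map `F^{1/2} : ⋀ ℂⁿ → L²(Spin(2n+1))`, `ψ ↦ (1, π^{1/2}(·) ψ)`. -/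
noncomputable def fockToL2 (n : ℕ) : Fock n →ₗ[ℂ] L2Spin (2 * n + 1) where
  toFun ψ := (memLp_of_continuous (continuous_fockFun n ψ)).toLp (fockFun n ψ)
  map_add' ψ φ := by
    rw [← MemLp.toLp_add]
    congr 1
    ext g
    simp [fockFun]
  map_smul' c ψ := by
    rw [RingHom.id_apply, ← MemLp.toLp_const_smul]
    congr 1
    ext g
    simp [fockFun]

/-- The range `F_{Ψ₀}` of `F^{1/2}`. -/
noncomputable def fockRange (n : ℕ) : Submodule ℂ (L2Spin (2 * n + 1)) :=
  LinearMap.range (fockToL2 n)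

end Embedding

end SpinFock

open SpinFock

namespace SpinFock

open CliffordAlgebra MeasureTheory

/-! ### Cyclicity of the vacuum: its matrix coefficients determine a vector of the Fock space. -/

section Cyclic

variable {n : ℕ}

/-! The one substantial point is injectivity: a vector ψ with (1, π(g)ψ) = 0 for every g in
Spin(2n+1) must vanish. Let K be the complex subspace of all such ψ. Taking g = 1 shows that K is
orthogonal to the vacuum, and replacing g by kg shows that K is invariant under the group. Now γ_j
is itself the operator of a group element, namely of the product e_N e_j of two unit vectors
(`exists_spinRep_eq_gammaE`), so K is invariant under every γ_j without any passage to the Lie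
algebra. The annihilation operators c(e_j) are complex combinations of the γ's
(`annihilation_eq_gammaE`), hence preserve K too. Since c(e_j) is the adjoint of e_j ∧ ·, an
induction on the size of S shows that K is orthogonal to every e_S
(`eq_zero_of_annihilation_invariant`), so K = 0.

To pass from functions to L² classes, note that g ↦ (1, π(g)ψ) is the restriction to the group of a
real linear map on the Clifford algebra; it is therefore smooth. A continuous function that vanishes
almost everywhere for Haar measure vanishes identically (`smoothToL2_injective`). Together these
facts make F^{1/2} injective, and an injective linear map from a finite-dimensional space into a
Hilbert space is a homeomorphism onto its image.

The intertwining relations are direct computations. For the group, (1, π(xg)ψ) = (1, π(x) π(g)ψ).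
For the Lie algebra, the curve t ↦ π(e^{tX})ψ has derivative π(X)ψ at 0, and the functional (1, π(g)
·) is applied to it. The actions on the range are obtained by transport along F^{1/2}; the two
relations say that they are the restrictions of R and dR. -/

/-- Unit vectors lie in the Lipschitz group and satisfy u u* = u* u = 1; a product of two of them
inherits both properties and is even. -/
theorem vec_mul_vec_mem_spinGroup {N : ℕ} (hN : 0 < N) (u v : EuclideanSpace ℝ (Fin N))
    (hu : ‖u‖ = 1) (hv : ‖v‖ = 1) : vec u * vec v ∈ spinGroup (negForm N) := by
  have hl : ∀ w ∈ [u, v], ‖w‖ = 1 := by simp [hu, hv]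
  have hm := mem_lipschitz_of_prod hN 1 (Or.inl rfl) [u, v] hl
  obtain ⟨h1, h2⟩ := star_prod_mul_self [u, v] hl
  simp only [List.map_cons, List.map_nil, List.prod_cons, List.prod_nil, mul_one, one_smul]
    at hm h1 h2
  exact ⟨⟨hm, h1, h2⟩, ι_mul_ι_mem_evenOdd_zero _ _ _⟩

/-- The operators `γ_j` belong to the image of the spin group. -/
theorem exists_spinRep_eq_gammaE (j : Fin (2 * n)) :
    ∃ g : Spin (2 * n + 1), spinRep n g = gammaE n j := by
  -- The group element is e_N e_j, in this order: the bilinear map sends (e_N, e_j) to (0 + 1)(γ_j -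
  -- 0) = γ_j, while e_j e_N would give -γ_j.
  refine ⟨⟨_, vec_mul_vec_mem_spinGroup (Nat.succ_pos _)
    (EuclideanSpace.single (Fin.last (2 * n)) 1) (EuclideanSpace.single j.castSucc 1)
    (by simp) (by simp)⟩, (evenRep_ι_mul_ι _ _).trans ?_⟩
  simp [evenBilin_apply, initVec_castSucc, initVec_last, gammaE, (Fin.castSucc_ne_last _).symm]

/-- Parity in the name refers to numbering from 1: the index `2 * j` counted from 0 is the odd index
2(j+1) - 1 of the informal statement. -/
theorem gammaE_odd (j : Fin n) : gammaE n ⟨2 * j, by omega⟩ =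
    creation n (EuclideanSpace.single j 1) - annihilation n (EuclideanSpace.single j 1) := by
  have h1 : projOdd n (EuclideanSpace.single ⟨2 * j, by omega⟩ 1) = EuclideanSpace.single j 1 := by
    ext k
    simp [projOdd, Fin.ext_iff, apply_ite]
  have h2 : projEven n (EuclideanSpace.single ⟨2 * j, by omega⟩ 1) = 0 := by
    ext k
    have : ¬ (2 * (k : ℕ) + 1 = 2 * j) := by omega
    simp [projEven, Fin.ext_iff, this]
  rw [gammaE, gamma_apply, h1, h2]
  simp

theorem gammaE_even (j : Fin n) : gammaE n ⟨2 * j + 1, by omega⟩ = -(Complex.I •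
    (creation n (EuclideanSpace.single j 1) + annihilation n (EuclideanSpace.single j 1))) := by
  have h1 : projOdd n (EuclideanSpace.single ⟨2 * j + 1, by omega⟩ 1) = 0 := by
    ext k
    have : ¬ (2 * (k : ℕ) = 2 * j + 1) := by omega
    simp [projOdd, Fin.ext_iff, this]
  have h2 : projEven n (EuclideanSpace.single ⟨2 * j + 1, by omega⟩ 1) =
      EuclideanSpace.single j 1 := by
    ext k
    simp [projEven, Fin.ext_iff, apply_ite]
  rw [gammaE, gamma_apply, h1, h2]
  simp

/-- With indices from 1, i γ_{2j} = c†(e_j) + c(e_j) and γ_{2j-1} = c†(e_j) - c(e_j), so subtracting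
removes the creation operator and leaves 2 c(e_j). The coefficient i is the reason for working with
complex subspaces. -/
theorem annihilation_eq_gammaE (j : Fin n) : annihilation n (EuclideanSpace.single j 1) =
    (1 / 2 : ℂ) • (Complex.I • gammaE n ⟨2 * j + 1, by omega⟩ -
      gammaE n ⟨2 * j, by omega⟩) := by
  rw [gammaE_odd, gammaE_even, smul_neg, smul_smul, Complex.I_mul_I]
  module

theorem exteriorBasis_empty {I V : Type*} [LinearOrder I] [AddCommGroup V] [Module ℂ V]
    (b : Module.Basis I ℂ V) : b.ExteriorAlgebra ∅ = 1 := by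
  rw [ExteriorAlgebra.basis_apply_ofCard b Finset.card_empty, ExteriorAlgebra.ιMulti_family,
    ExteriorAlgebra.ιMulti_zero_apply]

/-- The vacuum is a member of the orthonormal basis; this starts the induction over S below. -/
theorem fockBasis_empty : fockBasis n ∅ = 1 := exteriorBasis_empty _

/-- A subspace orthogonal to the vacuum and invariant under the annihilation operators vanishes. -/
theorem eq_zero_of_annihilation_invariant (K : Submodule ℂ (Fock n))
    (h1 : ∀ ψ ∈ K, inner ℂ (1 : Fock n) ψ = 0)
    (hK : ∀ j, ∀ ψ ∈ K, annihilation n (EuclideanSpace.single j 1) ψ ∈ K)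
    {ψ : Fock n} (hψ : ψ ∈ K) : ψ = 0 := by
  -- All φ in K are treated at once, because the inductive step for φ uses the hypothesis for c(e_i)
  -- φ.
  have key : ∀ S : Finset (Fin n), ∀ φ ∈ K, inner ℂ (fockBasis n S) φ = 0 := by
    intro S
    induction S using Finset.induction_on with
    | empty => simpa only [fockBasis_empty] using h1
    | insert i S hi ih =>
      intro φ hφ
      obtain ⟨σ, hσ⟩ := ι_mul_exteriorBasis (EuclideanSpace.basisFun (Fin n) ℂ).toBasis i S hi
      have hc : creation n (EuclideanSpace.single i 1) (fockBasis n S) =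
          ((σ : ℤ) : ℂ) • fockBasis n (insert i S) := by
        rw [OrthonormalBasis.coe_toBasis, EuclideanSpace.basisFun_apply] at hσ
        exact hσ
      have h := ih _ (hK i φ hφ)
      -- Moving the adjoint across: 0 = (e_S, c(e_i) φ) = (e_i ∧ e_S, φ), and e_i ∧ e_S is e_{S ∪
      -- {i}} up to a sign.
      rw [annihilation_eq_adjoint, LinearMap.adjoint_inner_right, hc, inner_smul_left] at h
      refine (mul_eq_zero.mp h).resolve_left ?_
      simp
  -- The scalar product with e_S is the coordinate at S, so all coordinates of ψ vanish.
  refine (fockBasis n).ext_elem fun S => ?_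
  have h := key S ψ hψ
  rw [fock_inner_def, Finset.sum_eq_single S] at h
  · simpa using h
  · intro T _ hT
    simp [hT.symm]
  · simp

/-- The vacuum matrix coefficients separate the vectors of the Fock space. -/
theorem eq_zero_of_fockFun_eq_zero {ψ : Fock n} (h : fockFun n ψ = 0) : ψ = 0 := by
  -- K collects all vectors whose vacuum coefficient vanishes on the whole group; it is shown to
  -- meet the hypotheses of `eq_zero_of_annihilation_invariant`.
  let K : Submodule ℂ (Fock n) :=
    { carrier := {φ | ∀ g, fockFun n φ g = 0}
      add_mem' := fun {φ χ} hφ hχ g => by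
        have e1 := hφ g
        have e2 := hχ g
        simp only [fockFun] at e1 e2 ⊢
        rw [map_add, inner_add_right, e1, e2, add_zero]
      zero_mem' := fun g => by simp [fockFun]
      smul_mem' := fun c φ hφ g => by
        have e1 := hφ g
        simp only [fockFun] at e1 ⊢
        rw [map_smul, inner_smul_right, e1, mul_zero] }
  have hg : ∀ g, ∀ φ ∈ K, spinRep n g φ ∈ K := by
    intro g φ hφ k
    -- The coefficient of π(g)φ at k is the coefficient of φ at kg.
    have := hφ (k * g)
    rwa [fockFun, map_mul] at this
  have hγ : ∀ j, ∀ φ ∈ K, gammaE n j φ ∈ K := by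
    intro j φ hφ
    obtain ⟨g, e⟩ := exists_spinRep_eq_gammaE j
    exact e ▸ hg g φ hφ
  refine eq_zero_of_annihilation_invariant K (fun φ hφ => ?_) (fun j φ hφ => ?_)
    (ψ := ψ) (fun g => congrFun h g)
  -- At the identity of the group the coefficient is (1, φ) itself.
  · have := hφ 1
    rwa [fockFun, map_one] at this
  · rw [annihilation_eq_gammaE]
    exact K.smul_mem _ (K.sub_mem (K.smul_mem _ (hγ _ φ hφ)) (hγ _ φ hφ))

end Cyclic

/-! ### Vacuum matrix coefficients as smooth functions and as L² classes. -/

section MatrixCoefficients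

/-- Haar measure is positive on nonempty open sets, so continuous functions that agree almost
everywhere agree. Thus an L² class has at most one smooth representative, which gives an unambiguous
meaning to dR on classes that have one. -/
theorem smoothToL2_injective (N : ℕ) [NeZero N] : Function.Injective (smoothToL2 N) := by
  intro f₁ f₂ h
  have h' := (MemLp.toLp_eq_toLp_iff (memLp_of_continuous (continuous_of_smooth f₁.2))
    (memLp_of_continuous (continuous_of_smooth f₂.2))).mp h
  exact Subtype.ext ((Continuous.ae_eq_iff_eq (spinHaar N) (continuous_of_smooth f₁.2)
    (continuous_of_smooth f₂.2)).mp h')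

variable (n : ℕ)

/-- The coefficient depends linearly on g as an element of the Clifford algebra, so a single linear
function on the ambient space serves near every point. -/
theorem fockFun_mem_smoothFunctions (ψ : Fock n) :
    fockFun n ψ ∈ smoothFunctions (2 * n + 1) := by
  let l : even (negForm (2 * n + 1)) →ₗ[ℝ] ℂ :=
    { toFun := fun x => inner ℂ (1 : Fock n) (evenRep n x ψ)
      map_add' := fun x y => by rw [map_add, LinearMap.add_apply, inner_add_right]
      map_smul' := fun c x => by
        rw [map_smul]
        exact inner_smul_right (𝕜 := ℂ) _ _ (c : ℂ) }
  -- The representation is defined on the even subalgebra only, whereas smoothness is tested by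
  -- functions on the whole Clifford algebra; any linear extension will do.
  obtain ⟨L, hL⟩ := LinearMap.exists_extend
    (p := Subalgebra.toSubmodule (even (negForm (2 * n + 1)))) l
  refine fun g => ⟨Set.univ, isOpen_univ, trivial, L,
    (LinearMap.toContinuousLinearMap L).contDiff, fun x _ => ?_⟩
  exact (congrArg (fun f => f ⟨x.1, spinGroup.mem_even x.2⟩) hL).symm

/-- Bridge between the two pictures: identities in L² are reduced through it to identities of smooth
functions. -/
theorem smoothToL2_fockFun (ψ : Fock n) :
    smoothToL2 (2 * n + 1) ⟨fockFun n ψ, fockFun_mem_smoothFunctions n ψ⟩ = fockToL2 n ψ := rfl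

/-- If the class is zero, so is its smooth representative, and the vacuum coefficients separate
vectors. -/
theorem fockToL2_injective : Function.Injective (fockToL2 n) := by
  rw [injective_iff_map_eq_zero]
  intro ψ h
  rw [← smoothToL2_fockFun] at h
  have h' := smoothToL2_injective _ (h.trans (map_zero (smoothToL2 (2 * n + 1))).symm)
  exact eq_zero_of_fockFun_eq_zero (congrArg Subtype.val h')

/-- Multiplicativity of π, π(xg)ψ = π(x)(π(g)ψ), read pointwise in x. -/
theorem rightRegular_fockToL2 (g : Spin (2 * n + 1)) (ψ : Fock n) :
    rightRegular (2 * n + 1) g (fockToL2 n ψ) = fockToL2 n (spinRep n g ψ) := by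
  refine (Lp.toLp_compMeasurePreserving (memLp_of_continuous (continuous_fockFun n ψ))
    (measurePreserving_mul_right (spinHaar (2 * n + 1)) g)).trans ?_
  have h : fockFun n ψ ∘ (fun x => x * g) = fockFun n (spinRep n g ψ) := by
    ext x
    simp [fockFun]
  exact MemLp.toLp_congr _ (memLp_of_continuous (continuous_fockFun n _))
    (Filter.Eventually.of_forall fun x => congrFun h x)

/-- The derivative at 0 of t ↦ (1, π(g) π(e^{tX})ψ) is obtained by applying a fixed continuous
functional to the derivative of the curve π(e^{tX})ψ. -/
theorem dR_fockFun (X : so (2 * n + 1)) (ψ : Fock n) :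
    dR X ⟨fockFun n ψ, fockFun_mem_smoothFunctions n ψ⟩ =
      ⟨fockFun n (spinLieRep n X ψ), fockFun_mem_smoothFunctions n _⟩ := by
  ext g
  rw [dR_apply]
  -- The functional (1, π(g) ·). It is complex linear, but the curve has a real parameter, so the
  -- chain rule is applied after restricting scalars to ℝ.
  let L : Fock n →L[ℂ] ℂ := (innerSL ℂ (1 : Fock n)).comp
    (LinearMap.toContinuousLinearMap (spinRep n g))
  have h := (L.restrictScalars ℝ).hasFDerivAt.comp_hasDerivAt (0 : ℝ) (hasDerivAt_spinRep n X ψ)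
  have e : (fun t : ℝ => fockFun n ψ (g * spinExp (t • X))) =
      (L.restrictScalars ℝ) ∘ fun t : ℝ => spinRep n (spinExp (t • X)) ψ := by
    ext t
    simp [L, fockFun]
  change deriv (fun t : ℝ => fockFun n ψ (g * spinExp (t • X))) 0 = _
  rw [e]
  exact h.deriv

/-- The orbit map is the restriction of a linear map on the finite-dimensional even subalgebra. It
supplies the continuity of the representation on the range. -/
theorem continuous_spinRep_apply (ψ : Fock n) :
    Continuous fun g : Spin (2 * n + 1) => spinRep n g ψ := by
  let l : even (negForm (2 * n + 1)) →ₗ[ℝ] Fock n :=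
    { toFun := fun x => evenRep n x ψ
      map_add' := fun x y => by rw [map_add, LinearMap.add_apply]
      map_smul' := fun c x => by rw [map_smul]; rfl }
  have h : Continuous l := l.continuous_of_finiteDimensional
  exact h.comp (f := fun g : Spin (2 * n + 1) =>
    (⟨g.1, spinGroup.mem_even g.2⟩ : even (negForm (2 * n + 1))))
    (Continuous.subtype_mk continuous_subtype_val _)

end MatrixCoefficients

end SpinFock

/-! ### The embedding and the two representations on its range. -/

/-- Invariance of the range is encoded by the types of σ and ρ: their operators map the range to
itself and agree there with R and dR. As dR acts on functions and not on classes, the clause for ρ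
speaks of a smooth representative f of F; one exists by the inclusion of the range in the image of
the smooth functions, and it is unique by `smoothToL2_injective`. -/
theorem mainTheorem5 (n : ℕ) :
    Topology.IsEmbedding (fockToL2 n) ∧
    (∀ ψ : Fock n, fockFun n ψ ∈ smoothFunctions (2 * n + 1)) ∧
    fockRange n ≤ LinearMap.range (smoothToL2 (2 * n + 1)) ∧
    ∃ e : Fock n ≃ₗ[ℂ] fockRange n,
      (∀ ψ : Fock n, (e ψ : L2Spin (2 * n + 1)) = fockToL2 n ψ) ∧
      (∃ σ : Representation ℂ (Spin (2 * n + 1)) (fockRange n),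
        (∀ (g : Spin (2 * n + 1)) (f : fockRange n),
          (σ g f : L2Spin (2 * n + 1)) = rightRegular (2 * n + 1) g f) ∧
        (∀ f : fockRange n, Continuous fun g : Spin (2 * n + 1) => σ g f) ∧
        ∀ (g : Spin (2 * n + 1)) (ψ : Fock n), σ g (e ψ) = e (spinRep n g ψ)) ∧
      ∃ ρ : so (2 * n + 1) →ₗ⁅ℝ⁆ Module.End ℂ (fockRange n),
        (∀ (X : so (2 * n + 1)) (f : smoothFunctions (2 * n + 1)) (F : fockRange n),
          smoothToL2 (2 * n + 1) f = F →
            (ρ X F : L2Spin (2 * n + 1)) = smoothToL2 (2 * n + 1) (dR X f)) ∧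
        ∀ (X : so (2 * n + 1)) (ψ : Fock n), ρ X (e ψ) = e (spinLieRep n X ψ) := by
  have hinj := fockToL2_injective n
  -- On a finite-dimensional space, injectivity alone makes a linear map into a Hausdorff
  -- topological vector space a closed embedding.
  refine ⟨(LinearMap.isClosedEmbedding_of_injective (LinearMap.ker_eq_bot.mpr hinj)).isEmbedding,
    fockFun_mem_smoothFunctions n, ?_, LinearEquiv.ofInjective (fockToL2 n) hinj, fun ψ => rfl,
    ?_, ?_⟩
  · rintro _ ⟨ψ, rfl⟩
    exact ⟨_, smoothToL2_fockFun n ψ⟩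
  all_goals
    set e : Fock n ≃ₗ[ℂ] fockRange n := LinearEquiv.ofInjective (fockToL2 n) hinj
    have hval : ∀ ψ, (e ψ : L2Spin (2 * n + 1)) = fockToL2 n ψ := fun ψ => rfl
  -- σ is the spin representation conjugated by e, so it intertwines by construction; what has to be
  -- checked is that it restricts R.
  · refine ⟨(e.conjRingEquiv : Module.End ℂ (Fock n) →* _).comp (spinRep n), ?_, ?_, ?_⟩
    · intro g f
      obtain ⟨ψ, rfl⟩ := e.surjective f
      rw [hval, rightRegular_fockToL2, ← hval]
      simp [LinearEquiv.conjRingEquiv]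
    · intro f
      -- The orbit of f is the image under e of the orbit of its preimage, and e is continuous
      -- because its source is finite-dimensional.
      have hc : Continuous e := LinearMap.continuous_of_finiteDimensional e.toLinearMap
      exact hc.comp (continuous_spinRep_apply n (e.symm f))
    · intro g ψ
      simp [LinearEquiv.conjRingEquiv]
  · let ρ : so (2 * n + 1) →ₗ⁅ℝ⁆ Module.End ℂ (fockRange n) :=
      { toFun := fun X => e.conj (spinLieRep n X)
        map_add' := fun X Y => by rw [map_add, map_add]
        map_smul' := fun c X => by
          rw [map_smul]
          -- Conjugation by e is complex linear; a real scalar acts as the corresponding complex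
          -- one.
          exact map_smul e.conj (c : ℂ) _
        map_lie' := fun {X Y} => by
          rw [LieHom.map_lie]
          exact LieEquiv.map_lie e.lieConj _ _ }
    have hρ : ∀ X ψ, ρ X (e ψ) = e (spinLieRep n X ψ) := fun X ψ => by
      simp [ρ, LinearEquiv.conj_apply]
    refine ⟨ρ, fun X f F hf => ?_, hρ⟩
    obtain ⟨ψ, rfl⟩ := e.surjective F
    rw [hval, ← smoothToL2_fockFun] at hf
    -- Since f has the same class as the coefficient of ψ, it is that coefficient, and dR of it is
    -- already known.
    rw [smoothToL2_injective _ hf, dR_fockFun, smoothToL2_fockFun, hρ, hval]
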